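/- Let $\mathbb F=\mathbb R$ or $\mathbb C$, let $X$ be a smooth manifold (Hausdorff, second countable, without boundary), and let $Y\subset X$ be a non-empty closed submanifold, without boundary, of $\mathbb F$-codimension $\mathfrak c$ and real dimension $m$, with normal bundle $\pi_{\mathcal N}:\mathcal N_XY=TX|_Y/TY\to Y$. Definitions. A smooth coordinate chart $\varphi=(\varphi_1,\dots,\varphi_{\mathfrak c+m}):U\to\mathbb F^{\mathfrak c}\times\mathbb R^m$ on $X$ is a *chart for $Y$ in $X$* if $U\cap Y=\{x\in U:\varphi_1(x)=\dots=\varphi_{\mathfrak c}(x)=0\}$. A collection $\{\varphi_\alpha:U_\alpha\to\mathbb F^{\mathfrak c}\times\mathbb R^m\}_{\alpha\in\mathcal I}$ of charts for $Y$ in $X$ is an *$\mathbb F$-atlas for $Y$ in $X$* if the sets $U_\alpha$ cover $Y$ and for all $\alpha,\alpha'\in\mathcal I$ there is a smooth map $h_{\alpha\alpha'}:\varphi_{\alpha'}(U_\alpha\cap U_{\alpha'})\to\mathrm{End}_{\mathbb F}(\mathbb F^{\mathfrak c})$ such that the first $\mathfrak c$ components of $\varphi_\alpha\circ\varphi_{\alpha'}^{-1}(r,s)$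 are $h_{\alpha\alpha'}(r,s)r$ for all $(r,s)\in\varphi_{\alpha'}(U_\alpha\cap U_{\alpha'})$. Two $\mathbb F$-atlases are *$\mathbb F$-equivalent* if their union is an $\mathbb F$-atlas. An $\mathbb F$-atlas makes $\mathcal N_XY$ an $\mathbb F$-vector bundle, via the isomorphisms $\mathbb F^{\mathfrak c}\to\mathcal N_XY|_x$, $r\mapsto\sum_{j=1}^{\mathfrak c} r_j\frac{\partial}{\partial\varphi_{\alpha;j}}\big|_x+T_xY$, for $x\in U_\alpha\cap Y$. A *tubular neighborhood identification* for $Y\subset X$ is a pair $(W_Y,\Psi_Y)$ consisting of an open neighborhood $W_Y$ of (the zero section) $Y$ in $\mathcal N_XY$ and a diffeomorphism $\Psi_Y$ from $W_Y$ onto an open neighborhood of $Y$ in $X$ such that $\Psi_Y|_Y=\mathrm{id}_Y$ and the composition of $\mathrm d\Psi_Y:T(\mathcal N_XY)|_Y\to TX|_Y$ with the projection $TX|_Y\to\mathcal N_XY$ restricts to the identity on $\mathcal N_XY\subset T(\mathcal N_XY)|_Y$. Given an $\mathbb F$-vector bundle structure on $\mathcal N_XY$, a *chart cut out from $(W_Y,\Psi_Y)$*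 is a map $\Phi\circ\Psi_Y^{-1}$ on $\Psi_Y(W_Y\cap\pi_{\mathcal N}^{-1}(U))$, where $U\subset Y$ is open and $\Phi:\mathcal N_XY|_U\to\mathbb F^{\mathfrak c}\times\mathbb R^m$ is a smooth coordinate chart on $\mathcal N_XY|_U$ whose first $\mathfrak c$ components restrict to an $\mathbb F$-linear isomorphism on each fiber and whose last $m$ components factor through $\pi_{\mathcal N}$. An *$\mathbb F$-atlas cut out from $(W_Y,\Psi_Y)$* is a collection of such charts whose domains cover $Y$. Statement. Let $\{\varphi_\alpha\}_{\alpha\in\mathcal I}$ be an $\mathbb F$-atlas for $Y$ in $X$, and give $\mathcal N_XY$ the $\mathbb F$-vector bundle structure that it determines. There exists a tubular neighborhood identification $(W_Y,\Psi_Y)$ for $Y\subset X$ such that every $\mathbb F$-atlas for $Y$ in $X$ cut out from $(W_Y,\Psi_Y)$ is $\mathbb F$-equivalent to $\{\varphi_\alpha\}_{\alpha\in\mathcal I}$. -/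

import Mathlib

open Set Topology
open scoped Manifold ContDiff

noncomputable section

namespace Blowup

/-- The local model `𝔽^c × ℝ^m`, regarded as a finite-dimensional real normed space. -/
abbrev LocalModel (𝔽 : Type*) (c m : ℕ) : Type _ := (Fin c → 𝔽) × (Fin m → ℝ)

/-- A smooth coordinate chart `φ : U → 𝔽^c × ℝ^m` on `X` is a chart for `Y` in `X` if
`U ∩ Y = {x ∈ U : φ₁(x) = … = φ_c(x) = 0}`. -/
structure IsChartFor {𝔽 : Type*} [RCLike 𝔽] {c m n : ℕ} {X : Type*} [TopologicalSpace X]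
    [ChartedSpace (EuclideanSpace ℝ (Fin n)) X] (Y : Set X)
    (φ : OpenPartialHomeomorph X (LocalModel 𝔽 c m)) : Prop where
  smooth : ContMDiffOn 𝓘(ℝ, EuclideanSpace ℝ (Fin n)) 𝓘(ℝ, LocalModel 𝔽 c m) ∞ φ φ.source
  smooth_symm :
    ContMDiffOn 𝓘(ℝ, LocalModel 𝔽 c m) 𝓘(ℝ, EuclideanSpace ℝ (Fin n)) ∞ φ.symm φ.target
  slice : ∀ x ∈ φ.source, x ∈ Y ↔ (φ x).1 = 0

/-- A closed submanifold of `𝔽`-codimension `c` and real dimension `m`, without boundary, of the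
`n`-manifold `X`: a closed subset which near each of its points is a coordinate slice. -/
structure ClosedSubmanifold (𝔽 : Type*) [RCLike 𝔽] (c m n : ℕ) (X : Type*) [TopologicalSpace X]
    [ChartedSpace (EuclideanSpace ℝ (Fin n)) X] where
  carrier : Set X
  isClosed : IsClosed carrier
  exists_chart : ∀ y ∈ carrier, ∃ φ : OpenPartialHomeomorph X (LocalModel 𝔽 c m),
    IsChartFor (n := n) carrier φ ∧ y ∈ φ.source

/-- The tangent space `T_y Y ⊂ T_y X`: the span of the velocities at `y` of the smooth curves
through `y` in `Y`. -/
def tangentSub (n : ℕ) {X : Type*} [TopologicalSpace X]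
    [ChartedSpace (EuclideanSpace ℝ (Fin n)) X] (Y : Set X) (y : X) :
    Submodule ℝ (TangentSpace 𝓘(ℝ, EuclideanSpace ℝ (Fin n)) y) :=
  Submodule.span ℝ {v | ∃ γ : ℝ → X, ∃ h0 : γ 0 = y,
    ContMDiffAt 𝓘(ℝ, ℝ) 𝓘(ℝ, EuclideanSpace ℝ (Fin n)) ∞ γ 0 ∧ (∀ᶠ t in 𝓝 0, γ t ∈ Y) ∧
    h0 ▸ mfderiv 𝓘(ℝ, ℝ) 𝓘(ℝ, EuclideanSpace ℝ (Fin n)) γ 0 (1 : ℝ) = v}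

/-- The fiber `T_y X / T_y Y` of the normal bundle of `Y` in `X`. -/
abbrev NormalSpace (n : ℕ) {X : Type*} [TopologicalSpace X]
    [ChartedSpace (EuclideanSpace ℝ (Fin n)) X] (Y : Set X) (y : X) : Type :=
  TangentSpace 𝓘(ℝ, EuclideanSpace ℝ (Fin n)) y ⧸ tangentSub n Y y

/-- For a chart `φ` for `Y` around `y`, the isomorphism
`𝔽^c → T_y X / T_y Y`, `r ↦ ∑ r_j ∂/∂φ_j + T_y Y`. -/
def normalFrame {𝔽 : Type*} [RCLike 𝔽] {c m : ℕ} (n : ℕ) {X : Type*} [TopologicalSpace X]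
    [ChartedSpace (EuclideanSpace ℝ (Fin n)) X] (Y : Set X)
    (φ : OpenPartialHomeomorph X (LocalModel 𝔽 c m)) (y : X) (r : Fin c → 𝔽) :
    NormalSpace n Y y :=
  (tangentSub n Y y).mkQ (mfderiv 𝓘(ℝ, LocalModel 𝔽 c m) 𝓘(ℝ, EuclideanSpace ℝ (Fin n))
    φ.symm (φ y) ((r, 0) : LocalModel 𝔽 c m))

/-- The inverse of `normalFrame`: the class of `w ∈ T_y X` has normal coordinates
`(dφ_y w)₁ ∈ 𝔽^c`. -/
def normalCoord {𝔽 : Type*} [RCLike 𝔽] {c m : ℕ} (n : ℕ) {X : Type*} [TopologicalSpace X]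
    [ChartedSpace (EuclideanSpace ℝ (Fin n)) X] (Y : Set X)
    (φ : OpenPartialHomeomorph X (LocalModel 𝔽 c m)) (y : X) (v : NormalSpace n Y y) :
    Fin c → 𝔽 :=
  Prod.fst (α := Fin c → 𝔽) (β := Fin m → ℝ)
    (mfderiv 𝓘(ℝ, EuclideanSpace ℝ (Fin n)) 𝓘(ℝ, LocalModel 𝔽 c m) φ y (Quotient.out v))

section Facts

variable {𝔽 : Type*} [RCLike 𝔽] {c m n : ℕ} {X : Type*} [TopologicalSpace X]
  [ChartedSpace (EuclideanSpace ℝ (Fin n)) X]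
  {Y : Set X} {φ φ' : OpenPartialHomeomorph X (LocalModel 𝔽 c m)} {y : X}

theorem IsChartFor.mdifferentiable (h : IsChartFor (n := n) Y φ) :
    φ.MDifferentiable 𝓘(ℝ, EuclideanSpace ℝ (Fin n)) 𝓘(ℝ, LocalModel 𝔽 c m) :=
  ⟨h.smooth.mdifferentiableOn (by simp), h.smooth_symm.mdifferentiableOn (by simp)⟩

theorem IsChartFor.apply_eq (h : IsChartFor (n := n) Y φ) (hs : y ∈ φ.source) (hy : y ∈ Y) :
    φ y = (0, (φ y).2) :=
  Prod.ext ((h.slice y hs).1 hy) rfl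

theorem IsChartFor.symm_mem (h : IsChartFor (n := n) Y φ) {s : Fin m → ℝ}
    (hs : ((0, s) : LocalModel 𝔽 c m) ∈ φ.target) : φ.symm (0, s) ∈ Y := by
  rw [h.slice _ (φ.map_target hs), φ.right_inv hs]

theorem IsChartFor.deriv_symm (h : IsChartFor (n := n) Y φ) (hs : y ∈ φ.source)
    (w : LocalModel 𝔽 c m) :
    mfderiv 𝓘(ℝ, EuclideanSpace ℝ (Fin n)) 𝓘(ℝ, LocalModel 𝔽 c m) φ y
      (mfderiv 𝓘(ℝ, LocalModel 𝔽 c m) 𝓘(ℝ, EuclideanSpace ℝ (Fin n)) φ.symm (φ y) w) = w := by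
  have := h.mdifferentiable.comp_symm_deriv (φ.map_source hs)
  rw [φ.left_inv hs] at this
  exact DFunLike.congr_fun this w

theorem IsChartFor.symm_deriv (h : IsChartFor (n := n) Y φ) (hs : y ∈ φ.source)
    (v : TangentSpace 𝓘(ℝ, EuclideanSpace ℝ (Fin n)) y) :
    mfderiv 𝓘(ℝ, LocalModel 𝔽 c m) 𝓘(ℝ, EuclideanSpace ℝ (Fin n)) φ.symm (φ y)
      (mfderiv 𝓘(ℝ, EuclideanSpace ℝ (Fin n)) 𝓘(ℝ, LocalModel 𝔽 c m) φ y v) = v :=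
  DFunLike.congr_fun (h.mdifferentiable.symm_comp_deriv hs) v

theorem IsChartFor.mem_tangentSub_iff (h : IsChartFor (n := n) Y φ) (hs : y ∈ φ.source)
    (hy : y ∈ Y) (v : TangentSpace 𝓘(ℝ, EuclideanSpace ℝ (Fin n)) y) :
    v ∈ tangentSub n Y y ↔ Prod.fst (α := Fin c → 𝔽) (β := Fin m → ℝ)
      (mfderiv 𝓘(ℝ, EuclideanSpace ℝ (Fin n)) 𝓘(ℝ, LocalModel 𝔽 c m) φ y v) = 0 := by
  constructor
  · intro hv
    let K : Submodule ℝ (TangentSpace 𝓘(ℝ, EuclideanSpace ℝ (Fin n)) y) :=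
      LinearMap.ker ((ContinuousLinearMap.fst ℝ (Fin c → 𝔽) (Fin m → ℝ)).toLinearMap.comp
        (mfderiv 𝓘(ℝ, EuclideanSpace ℝ (Fin n)) 𝓘(ℝ, LocalModel 𝔽 c m) φ y).toLinearMap)
    suffices tangentSub n Y y ≤ K from this hv
    refine Submodule.span_le.2 ?_
    rintro w ⟨γ, rfl, hγ, hY, rfl⟩
    have hγd : MDifferentiableAt 𝓘(ℝ, ℝ) 𝓘(ℝ, EuclideanSpace ℝ (Fin n)) γ 0 :=
      hγ.mdifferentiableAt (by simp)
    have hφd := h.mdifferentiable.mdifferentiableAt hs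
    have hc := mfderiv_comp (0 : ℝ) hφd hγd
    have hd : DifferentiableAt ℝ (φ ∘ γ) 0 := (hφd.comp (0 : ℝ) hγd).differentiableAt
    have e : (fun t => (φ (γ t)).1) =ᶠ[𝓝 0] fun _ => (0 : Fin c → 𝔽) := by
      filter_upwards [hY, hγ.continuousAt.preimage_mem_nhds (φ.open_source.mem_nhds hs)]
        with t h1 h2
      exact (h.slice _ h2).1 h1
    have e1 : fderiv ℝ (fun t => ((φ ∘ γ) t).1) 0 1 = (0 : Fin c → 𝔽) := by
      rw [show (fun t => ((φ ∘ γ) t).1) = fun t => (φ (γ t)).1 from rfl, e.fderiv_eq]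
      simp
    rw [fderiv.fst hd] at e1
    rw [mfderiv_eq_fderiv] at hc
    rw [hc] at e1
    exact e1
  · intro hv
    have hφy := h.apply_eq hs hy
    set w : LocalModel 𝔽 c m :=
      mfderiv 𝓘(ℝ, EuclideanSpace ℝ (Fin n)) 𝓘(ℝ, LocalModel 𝔽 c m) φ y v with hw
    let ℓ : ℝ → LocalModel 𝔽 c m := fun t => φ y + t • w
    have hℓ0 : ℓ 0 = φ y := by simp [ℓ]
    have hℓ : ContDiff ℝ ∞ ℓ := contDiff_const.add (contDiff_id.smul contDiff_const)
    have hℓd : HasFDerivAt ℓ ((1 : ℝ →L[ℝ] ℝ).smulRight w) 0 :=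
      ((hasDerivAt_id (0 : ℝ)).smul_const w).const_add (φ y) |>.hasFDerivAt.congr_fderiv
        (by ext <;> simp)
    have hmem : ℓ 0 ∈ φ.target := hℓ0 ▸ φ.map_source hs
    refine Submodule.subset_span ⟨φ.symm ∘ ℓ, ?_, ?_, ?_, ?_⟩
    · simp [hℓ0, φ.left_inv hs]
    · exact (h.smooth_symm.contMDiffAt (φ.open_target.mem_nhds hmem)).comp (0 : ℝ)
        hℓ.contMDiff.contMDiffAt
    · filter_upwards [hℓ.continuous.continuousAt.preimage_mem_nhds
        (φ.open_target.mem_nhds hmem)] with t ht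
      rw [Function.comp_apply, h.slice _ (φ.map_target ht), φ.right_inv ht]
      change (φ y).1 + t • w.1 = 0
      rw [hφy, show w.1 = 0 from hv]
      simp
    · have hd : HasMFDerivAt 𝓘(ℝ, ℝ) 𝓘(ℝ, EuclideanSpace ℝ (Fin n)) (φ.symm ∘ ℓ) 0 _ :=
        HasMFDerivAt.comp (0 : ℝ)
          (h.mdifferentiable.mdifferentiableAt_symm hmem).hasMFDerivAt hℓd.hasMFDerivAt
      rw [hd.mfderiv]
      have hcast : ∀ (x : X) (hx : x = y)
          (u : TangentSpace 𝓘(ℝ, EuclideanSpace ℝ (Fin n)) x),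
          (hx ▸ u : TangentSpace 𝓘(ℝ, EuclideanSpace ℝ (Fin n)) y) =
            (show EuclideanSpace ℝ (Fin n) from u) := by
        rintro x rfl u
        rfl
      refine (hcast _ _ _).trans ?_
      have key := h.symm_deriv hs v
      rw [← hw, ← hℓ0] at key
      refine Eq.trans ?_ key
      change mfderiv 𝓘(ℝ, LocalModel 𝔽 c m) 𝓘(ℝ, EuclideanSpace ℝ (Fin n)) φ.symm (ℓ 0)
        ((1 : ℝ) • w) = _
      rw [one_smul]

theorem IsChartFor.normalCoord_mk (h : IsChartFor (n := n) Y φ) (hs : y ∈ φ.source)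
    (hy : y ∈ Y) (v : TangentSpace 𝓘(ℝ, EuclideanSpace ℝ (Fin n)) y) :
    normalCoord n Y φ y ((tangentSub n Y y).mkQ v) = Prod.fst (α := Fin c → 𝔽) (β := Fin m → ℝ)
      (mfderiv 𝓘(ℝ, EuclideanSpace ℝ (Fin n)) 𝓘(ℝ, LocalModel 𝔽 c m) φ y v) := by
  have h1 : (tangentSub n Y y).mkQ (Quotient.out ((tangentSub n Y y).mkQ v)) =
      (tangentSub n Y y).mkQ v := Quotient.out_eq _
  have h2 : Quotient.out ((tangentSub n Y y).mkQ v) - v ∈ tangentSub n Y y :=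
    (Submodule.Quotient.eq _).1 h1
  rw [h.mem_tangentSub_iff hs hy, map_sub] at h2
  exact sub_eq_zero.1 h2

theorem IsChartFor.normalCoord_frame (h : IsChartFor (n := n) Y φ) (hs : y ∈ φ.source)
    (hy : y ∈ Y) (r : Fin c → 𝔽) : normalCoord n Y φ y (normalFrame n Y φ y r) = r := by
  have e := h.normalCoord_mk hs hy (mfderiv 𝓘(ℝ, LocalModel 𝔽 c m)
    𝓘(ℝ, EuclideanSpace ℝ (Fin n)) φ.symm (φ y) ((r, 0) : LocalModel 𝔽 c m))
  exact e.trans (congrArg Prod.fst (h.deriv_symm hs (r, 0)))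

theorem IsChartFor.normalFrame_coord (h : IsChartFor (n := n) Y φ) (hs : y ∈ φ.source)
    (hy : y ∈ Y) (v : NormalSpace n Y y) :
    normalFrame n Y φ y (normalCoord n Y φ y v) = v := by
  obtain ⟨w, rfl⟩ := (tangentSub n Y y).mkQ_surjective v
  rw [normalFrame]
  refine (Submodule.Quotient.eq _).2 ?_
  rw [h.mem_tangentSub_iff hs hy]
  have e1 := (mfderiv 𝓘(ℝ, EuclideanSpace ℝ (Fin n)) 𝓘(ℝ, LocalModel 𝔽 c m) φ y).map_sub
    (mfderiv 𝓘(ℝ, LocalModel 𝔽 c m) 𝓘(ℝ, EuclideanSpace ℝ (Fin n)) φ.symm (φ y)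
      ((normalCoord n Y φ y ((tangentSub n Y y).mkQ w), 0) : LocalModel 𝔽 c m)) w
  have e2 := h.deriv_symm hs (normalCoord n Y φ y ((tangentSub n Y y).mkQ w), 0)
  have e3 := h.normalCoord_mk hs hy w
  refine (congrArg (Prod.fst (α := Fin c → 𝔽) (β := Fin m → ℝ)) e1).trans ?_
  refine (congrArg (fun u : LocalModel 𝔽 c m => u.1 - Prod.fst (α := Fin c → 𝔽)
    (β := Fin m → ℝ) (mfderiv 𝓘(ℝ, EuclideanSpace ℝ (Fin n)) 𝓘(ℝ, LocalModel 𝔽 c m)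
      φ y w)) e2).trans ?_
  exact sub_eq_zero.2 e3

theorem IsChartFor.normalCoord_frame' (h : IsChartFor (n := n) Y φ)
    (h' : IsChartFor (n := n) Y φ') (hs : y ∈ φ.source) (hs' : y ∈ φ'.source)
    (hy : y ∈ Y) (r : Fin c → 𝔽) : normalCoord n Y φ' y (normalFrame n Y φ y r) =
      (fderiv ℝ (φ' ∘ φ.symm) (φ y) ((r, 0) : LocalModel 𝔽 c m)).1 := by
  have e := h'.normalCoord_mk hs' hy (mfderiv 𝓘(ℝ, LocalModel 𝔽 c m)
    𝓘(ℝ, EuclideanSpace ℝ (Fin n)) φ.symm (φ y) ((r, 0) : LocalModel 𝔽 c m))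
  rw [← mfderiv_eq_fderiv, mfderiv_comp (φ y) (I' := 𝓘(ℝ, EuclideanSpace ℝ (Fin n)))
    (by rw [φ.left_inv hs]; exact h'.mdifferentiable.mdifferentiableAt hs')
    (h.mdifferentiable.mdifferentiableAt_symm (φ.map_source hs)), φ.left_inv hs]
  exact e

theorem IsChartFor.contDiffOn_trans (h : IsChartFor (n := n) Y φ)
    (h' : IsChartFor (n := n) Y φ') :
    ContDiffOn ℝ ∞ (φ' ∘ φ.symm) (φ.symm ≫ₕ φ').source := by
  rw [← contMDiffOn_iff_contDiffOn]
  refine h'.smooth.comp (h.smooth_symm.mono ?_) ?_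
  · intro z hz
    simp at hz
    exact hz.1
  · intro z hz
    simp at hz
    exact hz.2

/-- The domain of the transition map between the charts of the normal bundle induced by
`φ` and `φ'`. -/
def transDomain (φ φ' : OpenPartialHomeomorph X (LocalModel 𝔽 c m)) : Set (LocalModel 𝔽 c m) :=
  {z | ((0, z.2) : LocalModel 𝔽 c m) ∈ (φ.symm ≫ₕ φ').source}

/-- The transition map between the charts of the normal bundle induced by `φ` and `φ'`. -/
def transMap (φ φ' : OpenPartialHomeomorph X (LocalModel 𝔽 c m)) (z : LocalModel 𝔽 c m) :
    LocalModel 𝔽 c m :=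
  ((fderiv ℝ (φ' ∘ φ.symm) (0, z.2) ((z.1, 0) : LocalModel 𝔽 c m)).1,
    (φ' (φ.symm (0, z.2))).2)

theorem isOpen_transDomain (φ φ' : OpenPartialHomeomorph X (LocalModel 𝔽 c m)) :
    IsOpen (transDomain φ φ') :=
  (φ.symm ≫ₕ φ').open_source.preimage
    (by fun_prop : Continuous fun z : LocalModel 𝔽 c m => ((0, z.2) : LocalModel 𝔽 c m))

theorem IsChartFor.contDiffOn_transMap (h : IsChartFor (n := n) Y φ)
    (h' : IsChartFor (n := n) Y φ') : ContDiffOn ℝ ∞ (transMap φ φ') (transDomain φ φ') := by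
  have h0 := h.contDiffOn_trans h'
  have hg : ContDiff ℝ ∞ fun z : LocalModel 𝔽 c m => ((0, z.2) : LocalModel 𝔽 c m) := by fun_prop
  have hm : MapsTo (fun z : LocalModel 𝔽 c m => ((0, z.2) : LocalModel 𝔽 c m))
      (transDomain φ φ') (φ.symm ≫ₕ φ').source := fun z hz => hz
  have h1 := h0.fderiv_of_isOpen (m := ∞) (φ.symm ≫ₕ φ').open_source (by simp)
  refine ContDiffOn.prodMk ?_ ?_
  · exact ContDiffOn.fst ((h1.comp hg.contDiffOn hm).clm_apply
      (by fun_prop : ContDiff ℝ ∞ fun z : LocalModel 𝔽 c m =>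
        ((z.1, 0) : LocalModel 𝔽 c m)).contDiffOn)
  · exact ContDiffOn.snd (h0.comp hg.contDiffOn hm)

end Facts

namespace ClosedSubmanifold

section NormalBundle

variable {𝔽 : Type*} [RCLike 𝔽] {c m n : ℕ} {X : Type*} [TopologicalSpace X]
  [ChartedSpace (EuclideanSpace ℝ (Fin n)) X] (Y : ClosedSubmanifold 𝔽 c m n X)

/-- The total space of the normal bundle `𝒩_X Y → Y` of `Y` in `X`. -/
structure NormalBundle where
  /-- the bundle projection `𝒩_X Y → Y ⊂ X` -/
  base : X
  base_mem : base ∈ Y.carrier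
  fiber : NormalSpace n Y.carrier base

variable {Y}

theorem NormalBundle.mk_congr {y y' : X} (e : y' = y) (hy : y ∈ Y.carrier)
    (hy' : y' ∈ Y.carrier) (f : ∀ x, NormalSpace n Y.carrier x) (v : NormalSpace n Y.carrier y)
    (hv : f y = v) : (⟨y', hy', f y'⟩ : Y.NormalBundle) = ⟨y, hy, v⟩ := by
  subst e; subst hv; rfl

/-- The inverse `(r, s) ↦ (y, ∑ r_j ∂/∂φ_j + T_y Y)`, with `y = φ⁻¹(0, s)`, of the chart of the
normal bundle induced by `φ`. Where it is undefined, it takes the irrelevant value `p`. -/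
def normalChartInv (φ : OpenPartialHomeomorph X (LocalModel 𝔽 c m))
    (h : IsChartFor (n := n) Y.carrier φ) (p : Y.NormalBundle) (z : LocalModel 𝔽 c m) :
    Y.NormalBundle :=
  open Classical in
  if hz : ((0, z.2) : LocalModel 𝔽 c m) ∈ φ.target then
    ⟨φ.symm (0, z.2), h.symm_mem hz, normalFrame n Y.carrier φ (φ.symm (0, z.2)) z.1⟩
  else p

theorem normalChartInv_eq {φ : OpenPartialHomeomorph X (LocalModel 𝔽 c m)}
    (h : IsChartFor (n := n) Y.carrier φ) (p : Y.NormalBundle) {z : LocalModel 𝔽 c m}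
    (hz : ((0, z.2) : LocalModel 𝔽 c m) ∈ φ.target) : normalChartInv φ h p z =
      ⟨φ.symm (0, z.2), h.symm_mem hz, normalFrame n Y.carrier φ (φ.symm (0, z.2)) z.1⟩ :=
  dif_pos hz

/-- The chart `(y, v) ↦ (normal coordinates of v, coordinates of y) ∈ 𝔽^c × ℝ^m` of the normal
bundle induced by a chart `φ` for `Y` in `X`, as a bijection between sets. -/
def normalChart (φ : OpenPartialHomeomorph X (LocalModel 𝔽 c m))
    (h : IsChartFor (n := n) Y.carrier φ) (p : Y.NormalBundle) :
    PartialEquiv Y.NormalBundle (LocalModel 𝔽 c m) where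
  toFun q := (normalCoord n Y.carrier φ q.base q.fiber, (φ q.base).2)
  invFun := normalChartInv φ h p
  source := {q | q.base ∈ φ.source}
  target := {z | ((0, z.2) : LocalModel 𝔽 c m) ∈ φ.target}
  map_source' q hq := by
    have := h.apply_eq hq q.base_mem
    simp [← this, φ.map_source hq]
  map_target' z hz := by
    have hz' : ((0, z.2) : LocalModel 𝔽 c m) ∈ φ.target := hz
    rw [normalChartInv_eq h p hz']
    exact φ.map_target hz'
  left_inv' q hq := by
    obtain ⟨y, hy, v⟩ := q
    have hys : y ∈ φ.source := hq
    have e := h.apply_eq hys hy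
    have hz : ((0, (φ y).2) : LocalModel 𝔽 c m) ∈ φ.target := e ▸ φ.map_source hys
    have e' : φ.symm (0, (φ y).2) = y := by rw [← e, φ.left_inv hys]
    refine (normalChartInv_eq h p (z := (normalCoord n Y.carrier φ y v, (φ y).2)) hz).trans ?_
    exact NormalBundle.mk_congr e' hy _
      (fun x => normalFrame n Y.carrier φ x (normalCoord n Y.carrier φ y v)) v
      (h.normalFrame_coord hys hy v)
  right_inv' z hz := by
    have hz' : ((0, z.2) : LocalModel 𝔽 c m) ∈ φ.target := hz
    rw [normalChartInv_eq h p hz', h.normalCoord_frame (φ.map_target hz') (h.symm_mem hz'),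
      φ.right_inv hz']

theorem normalChart_trans_source {φ φ' : OpenPartialHomeomorph X (LocalModel 𝔽 c m)}
    (h : IsChartFor (n := n) Y.carrier φ) (h' : IsChartFor (n := n) Y.carrier φ')
    (p p' : Y.NormalBundle) :
    ((normalChart φ h p).symm.trans (normalChart φ' h' p')).source = transDomain φ φ' := by
  ext z
  by_cases hz : ((0, z.2) : LocalModel 𝔽 c m) ∈ φ.target <;>
    simp [normalChart, transDomain, hz, normalChartInv_eq]

theorem normalChart_trans_apply {φ φ' : OpenPartialHomeomorph X (LocalModel 𝔽 c m)}
    (h : IsChartFor (n := n) Y.carrier φ) (h' : IsChartFor (n := n) Y.carrier φ')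
    (p p' : Y.NormalBundle) :
    EqOn ((normalChart φ h p).symm.trans (normalChart φ' h' p')) (transMap φ φ')
      (transDomain φ φ') := by
  intro z hz
  have hz' : ((0, z.2) : LocalModel 𝔽 c m) ∈ φ.target ∧ φ.symm (0, z.2) ∈ φ'.source := by
    simpa [transDomain] using hz
  have hs := φ.map_target hz'.1
  have := h.normalCoord_frame' h' hs hz'.2 (h.symm_mem hz'.1) z.1
  rw [φ.right_inv hz'.1] at this
  change normalChart φ' h' p' (normalChartInv φ h p z) = _
  rw [normalChartInv_eq h p hz'.1]
  exact Prod.ext this rfl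

variable (Y)

/-- The charts of the normal bundle induced by all charts for `Y` in `X`. -/
def normalBundleCore : ChartedSpaceCore (LocalModel 𝔽 c m) Y.NormalBundle where
  atlas := {e | ∃ φ, ∃ h : IsChartFor (n := n) Y.carrier φ, ∃ p, e = normalChart φ h p}
  chartAt q := normalChart _ (Y.exists_chart q.base q.base_mem).choose_spec.1 q
  mem_chart_source q := (Y.exists_chart q.base q.base_mem).choose_spec.2
  chart_mem_atlas q := ⟨_, _, _, rfl⟩
  open_source := by
    rintro _ _ ⟨φ, h, p, rfl⟩ ⟨φ', h', p', rfl⟩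
    rw [normalChart_trans_source]
    exact isOpen_transDomain φ φ'
  continuousOn_toFun := by
    rintro _ _ ⟨φ, h, p, rfl⟩ ⟨φ', h', p', rfl⟩
    rw [normalChart_trans_source]
    exact (h.contDiffOn_transMap h').continuousOn.congr (normalChart_trans_apply h h' p p')

instance : TopologicalSpace Y.NormalBundle := Y.normalBundleCore.toTopologicalSpace

instance : ChartedSpace (LocalModel 𝔽 c m) Y.NormalBundle := Y.normalBundleCore.toChartedSpace

instance : IsManifold 𝓘(ℝ, LocalModel 𝔽 c m) ∞ Y.NormalBundle := by
  refine isManifold_of_contDiffOn _ _ _ ?_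
  intro e e' he he'
  obtain ⟨_, ⟨_, rfl⟩, _, ⟨⟨φ, h, p, rfl⟩, rfl⟩, rfl⟩ := he
  obtain ⟨_, ⟨_, rfl⟩, _, ⟨⟨φ', h', p', rfl⟩, rfl⟩, rfl⟩ := he'
  have hd := (h.contDiffOn_transMap h').congr (normalChart_trans_apply h h' p p')
  rw [← normalChart_trans_source h h' p p'] at hd
  simp only [modelWithCornersSelf_coe, modelWithCornersSelf_coe_symm, Function.id_comp,
    Function.comp_id, range_id, inter_univ, preimage_id]
  exact hd

/-- The zero vector of the normal bundle over `y ∈ Y`; these form the copy of `Y` in `𝒩_X Y`. -/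
def zeroVec (y : X) (hy : y ∈ Y.carrier) : Y.NormalBundle := ⟨y, hy, 0⟩

/-- A tubular neighborhood identification `(W, Ψ)` for `Y ⊂ X` (over all of `Y`): a diffeomorphism
`Ψ` from the open neighborhood `W = Ψ.source` of `Y` in `𝒩_X Y` onto the open neighborhood
`Ψ.target` of `Y` in `X`, with `Ψ|_Y = id` and such that the composition of
`dΨ : T(𝒩_X Y)|_Y → TX|_Y` with the projection `TX|_Y → 𝒩_X Y` restricts to the identity on
`𝒩_X Y ⊂ T(𝒩_X Y)|_Y`, where `v ∈ 𝒩_X Y` is the velocity at `t = 0` of `t ↦ t v`. -/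
structure IsTubularNbhd (Ψ : OpenPartialHomeomorph Y.NormalBundle X) : Prop where
  smooth : ContMDiffOn 𝓘(ℝ, LocalModel 𝔽 c m) 𝓘(ℝ, EuclideanSpace ℝ (Fin n)) ∞ Ψ Ψ.source
  smooth_symm :
    ContMDiffOn 𝓘(ℝ, EuclideanSpace ℝ (Fin n)) 𝓘(ℝ, LocalModel 𝔽 c m) ∞ Ψ.symm Ψ.target
  zero_mem : ∀ y hy, Y.zeroVec y hy ∈ Ψ.source
  map_zero : ∀ y hy, Ψ (Y.zeroVec y hy) = y
  deriv_vertical : ∀ (y : X) (hy : y ∈ Y.carrier) (v : NormalSpace n Y.carrier y),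
    (tangentSub n Y.carrier y).mkQ
      (show TangentSpace 𝓘(ℝ, EuclideanSpace ℝ (Fin n)) y from
        mfderiv 𝓘(ℝ, ℝ) 𝓘(ℝ, EuclideanSpace ℝ (Fin n))
          (fun t : ℝ => Ψ ⟨y, hy, t • v⟩) 0 (1 : ℝ)) = v

/-- A collection `A` of charts for `Y` in `X` is an `𝔽`-atlas for `Y` in `X` if the domains of
these charts cover `Y` and, for all `φ, φ' ∈ A`, the overlap map `φ ∘ φ'⁻¹` satisfies
`((φ ∘ φ'⁻¹)₁, …, (φ ∘ φ'⁻¹)_c)(r, s) = h(r, s) r` for some smooth `h` with values in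
`End_𝔽(𝔽^c)`. -/
structure IsAtlas (A : Set (OpenPartialHomeomorph X (LocalModel 𝔽 c m))) : Prop where
  isChartFor : ∀ φ ∈ A, IsChartFor (n := n) Y.carrier φ
  cover : Y.carrier ⊆ ⋃ φ ∈ A, φ.source
  compatible : ∀ φ ∈ A, ∀ φ' ∈ A, ∃ h : LocalModel 𝔽 c m → (Fin c → 𝔽) →L[𝔽] (Fin c → 𝔽),
    ContDiffOn ℝ ∞ h (φ' '' (φ.source ∩ φ'.source)) ∧
    ∀ p ∈ φ' '' (φ.source ∩ φ'.source), (φ (φ'.symm p)).1 = h p p.1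

/-- Two `𝔽`-atlases for `Y` in `X` are `𝔽`-equivalent if their union is still an `𝔽`-atlas. -/
def AtlasEquiv (A B : Set (OpenPartialHomeomorph X (LocalModel 𝔽 c m))) : Prop :=
  Y.IsAtlas A ∧ Y.IsAtlas B ∧ Y.IsAtlas (A ∪ B)

/-- `Φ : 𝒩_X Y|_U → 𝔽^c × ℝ^m` is an `𝔽`-trivialization of the normal bundle over a coordinate
domain `U` of `Y`: a smooth chart on the preimage of `U` such that the last `m` components of `Φ`
factor through the bundle projection and the first `c` components restrict to an `𝔽`-linear
isomorphism on each fiber. The `𝔽`-vector space structure on the fibers is the one determined by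
the `𝔽`-atlas `A`, i.e. the one for which the isomorphisms `normalFrame φ y`, with `φ ∈ A`, are
`𝔽`-linear. -/
structure IsTrivialization (A : Set (OpenPartialHomeomorph X (LocalModel 𝔽 c m)))
    (Φ : OpenPartialHomeomorph Y.NormalBundle (LocalModel 𝔽 c m)) : Prop where
  smooth : ContMDiffOn 𝓘(ℝ, LocalModel 𝔽 c m) 𝓘(ℝ, LocalModel 𝔽 c m) ∞ Φ Φ.source
  smooth_symm : ContMDiffOn 𝓘(ℝ, LocalModel 𝔽 c m) 𝓘(ℝ, LocalModel 𝔽 c m) ∞ Φ.symm Φ.target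
  source_eq : ∃ U : Set X, IsOpen U ∧ Φ.source = {q | q.base ∈ U}
  base_coord : ∀ q ∈ Φ.source, ∀ q' ∈ Φ.source, q.base = q'.base → (Φ q).2 = (Φ q').2
  linear : ∀ (y : X) (hy : y ∈ Y.carrier), Y.zeroVec y hy ∈ Φ.source →
    ∀ φ ∈ A, y ∈ φ.source → ∃ T : (Fin c → 𝔽) ≃ₗ[𝔽] (Fin c → 𝔽),
      ∀ r, (Φ ⟨y, hy, normalFrame n Y.carrier φ y r⟩).1 = T r

/-- `φ` is a chart cut out from the tubular neighborhood identification `(W, Ψ)`: the chart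
`Φ ∘ Ψ⁻¹` on `Ψ(W|_U)` for an `𝔽`-trivialization `Φ` of `𝒩_X Y` over some `U ⊂ Y`, with respect
to the `𝔽`-structure on `𝒩_X Y` determined by the `𝔽`-atlas `A`. -/
def IsCutOutChart (A : Set (OpenPartialHomeomorph X (LocalModel 𝔽 c m)))
    (Ψ : OpenPartialHomeomorph Y.NormalBundle X)
    (φ : OpenPartialHomeomorph X (LocalModel 𝔽 c m)) : Prop :=
  ∃ Φ, Y.IsTrivialization A Φ ∧ φ ≈ Ψ.symm ≫ₕ Φ

/-- A collection of charts cut out from `(W, Ψ)` whose domains cover `Y`. -/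
structure IsCutOutAtlas (A : Set (OpenPartialHomeomorph X (LocalModel 𝔽 c m)))
    (Ψ : OpenPartialHomeomorph Y.NormalBundle X)
    (B : Set (OpenPartialHomeomorph X (LocalModel 𝔽 c m))) : Prop where
  cutOut : ∀ φ ∈ B, Y.IsCutOutChart A Ψ φ
  cover : Y.carrier ⊆ ⋃ φ ∈ B, φ.source

end NormalBundle

end ClosedSubmanifold

end Blowup

end

open Set Topology
open scoped Manifold ContDiff

noncomputable section

/-! An arbitrary tubular map ignores the `𝔽`-structure. What is needed is a diffeomorphism `Θ` from
a neighborhood of `Y` to the normal bundle whose normal component, in each chart of the atlas, is a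
smooth `𝔽`-linear operator applied to the normal coordinates. A single chart `ψ i` supplies such a
map on its domain, and the plan is to average these maps with a partition of unity `ρ i`. Different
charts assign different foot points in `Y` to the same `x`, so their normal vectors lie in different
fibers. Foot point and vector are therefore determined together, by the relation `IsRelated`. With
weights `ρ i x * ρ i y`, the mean of the tangent vectors at `y` with `ψ i`-coordinates `(0, s_i(x) -
s_i(y))` must vanish, and the mean of the normal vectors at `y` with coordinates `r_i(x)` is the
vector related to `x`.

Existence: in a chart `β` for `Y`, the linearization of the relation on the diagonal of `Y` is a
nonzero multiple of `L p.1 - p.2`, where `L` is a unipotent shear fixing normal components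
(`IsChartFor.hasFDerivAt_relFun`). Averaging preserves this triangular form, so invertibility
survives and the inverse function theorem gives local diffeomorphisms (`exists_local_diffeo`). They
all solve one globally defined relation, so uniqueness makes them agree and jointly injective on
small enough sets (`exists_glued_homeomorph`). As `L` fixes normal components, `Θ.symm` has the
required normal derivative.

Linearity: `r_i(x)` is an `𝔽`-linear operator applied to the `β`-normal coordinates of `x`, and at a
foot point in `Y` the normal block of the differential of `β ∘ (ψ i)⁻¹` is `𝔽`-linear as well. The
mean of these composites keeps this form (`exists_linear_factor`), and a fiberwise linear
trivialization only composes it with one more such operator.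

Equivalence of atlases: compatibility matters only for germs at points of `Y`
(`exists_contDiffOn_fst_eq`), where it is transitive and symmetric, so comparison with one chart of
the atlas at each point is enough. -/

namespace Blowup

/-! ### Inverse functions and graphs of relations. -/

section InverseFunction

variable {E F : Type*} [NormedAddCommGroup E] [NormedSpace ℝ E] [CompleteSpace E]
  [NormedAddCommGroup F] [NormedSpace ℝ F]

/-- The inverse function theorem with smoothness of the local inverse on its whole domain. -/
theorem exists_smooth_localInverse {f : E → F} {O : Set E} {a : E} {f' : E ≃L[ℝ] F}
    (hO : IsOpen O) (ha : a ∈ O) (hf : ContDiffOn ℝ ∞ f O)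
    (hf' : HasFDerivAt f (f' : E →L[ℝ] F) a) :
    ∃ e : OpenPartialHomeomorph E F, a ∈ e.source ∧ e.source ⊆ O ∧ (e : E → F) = f ∧
      ContDiffOn ℝ ∞ e.symm e.target := by
  have hfa : ContDiffAt ℝ ∞ f a := hf.contDiffAt (hO.mem_nhds ha)
  let e₀ := hfa.toOpenPartialHomeomorph f hf' (by simp)
  -- Invertibility of the derivative is an open condition; shrinking to it makes the inverse smooth
  -- at every target point, not only at the image of `a`.
  let V : Set E := O ∩ fderiv ℝ f ⁻¹' range ((↑) : (E ≃L[ℝ] F) → E →L[ℝ] F)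
  have hV : IsOpen V :=
    ((hf.fderiv_of_isOpen (m := 0) hO (by simp)).continuousOn).isOpen_inter_preimage hO
      (ContinuousLinearEquiv.isOpen)
  refine ⟨e₀.restrOpen V hV, ⟨hfa.mem_toOpenPartialHomeomorph_source hf' (by simp), ha, f',
    hf'.fderiv.symm⟩, fun x hx => hx.2.1, rfl, ?_⟩
  intro b hb
  obtain ⟨hbO, L, hL⟩ := ((e₀.restrOpen V hV).map_target hb).2
  have hd : ContDiffAt ℝ ∞ f ((e₀.restrOpen V hV).symm b) := hf.contDiffAt (hO.mem_nhds hbO)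
  refine ((e₀.restrOpen V hV).contDiffAt_symm (f₀' := L) hb ?_ hd).contDiffWithinAt
  rw [hL]
  exact (hd.differentiableAt (by simp)).hasFDerivAt

/-- If both partial derivatives of `K` at `(a, a)` are invertible, the relation `K (x, y) = 0`
is near `(a, a)` the graph of a local diffeomorphism. -/
theorem exists_localDiffeo_of_relation {K : E × E → E} {O : Set (E × E)} {a : E} {w : ℝ}
    {D : E × E →L[ℝ] E} {L : E ≃L[ℝ] E} (hO : IsOpen O) (ha : (a, a) ∈ O)
    (hK : ContDiffOn ℝ ∞ K O) (h0 : K (a, a) = 0) (hD : HasFDerivAt K D (a, a)) (hw : w ≠ 0)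
    (hDL : ∀ p, D p = w • (L p.1 - p.2)) :
    ∃ e : OpenPartialHomeomorph E E, a ∈ e.source ∧ e a = a ∧ ContDiffOn ℝ ∞ e e.source ∧
      ContDiffOn ℝ ∞ e.symm e.target ∧ HasFDerivAt e (L : E →L[ℝ] E) a ∧
      (∀ x ∈ e.source, (x, e x) ∈ O ∧ K (x, e x) = 0) ∧
      ∀ᶠ p in 𝓝 (a, a), K p = 0 → p.1 ∈ e.source ∧ e p.1 = p.2 := by
  -- Zeros of `K` are the preimages under `P` of the points `(x, 0)`. The differential of `P` is
  -- inverted by solving `v = w • (L u - u')` for `u' = L u - w⁻¹ • v`.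
  let P : E × E → E × E := fun p => (p.1, K p)
  have hP : ContDiffOn ℝ ∞ P O := contDiff_fst.contDiffOn.prodMk hK
  let P' : (E × E) ≃L[ℝ] (E × E) := ContinuousLinearEquiv.equivOfInverse
    ((ContinuousLinearMap.fst ℝ E E).prod D)
    ((ContinuousLinearMap.fst ℝ E E).prod
      ((L : E →L[ℝ] E).comp (ContinuousLinearMap.fst ℝ E E) -
        w⁻¹ • ContinuousLinearMap.snd ℝ E E))
    (fun p => by simp [hDL, smul_smul, hw]) (fun p => by simp [hDL, smul_smul, hw])
  have hPd : HasFDerivAt P (P' : (E × E) →L[ℝ] E × E) (a, a) :=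
    (hasFDerivAt_fst.prodMk hD).congr_fderiv (by ext <;> rfl)
  obtain ⟨Q, haQ, hQO, hQ, hQs⟩ := exists_smooth_localInverse hO ha hP hPd
  have hPa : P (a, a) = (a, 0) := by simp [P, h0]
  have hQa : Q (a, a) = (a, 0) := by rw [hQ, hPa]
  have hat : (a, (0 : E)) ∈ Q.target := hQa ▸ Q.map_source haQ
  have hQsa : Q.symm (a, 0) = (a, a) := by rw [← hQa, Q.left_inv haQ]
  let g : E → E := fun x => (Q.symm (x, 0)).2
  let i : E → E × E := fun x => (x, 0)
  have hi : ContDiff ℝ ∞ i := by fun_prop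
  let O' : Set E := i ⁻¹' Q.target
  have hO' : IsOpen O' := Q.open_target.preimage hi.continuous
  have hg : ContDiffOn ℝ ∞ g O' := (hQs.comp hi.contDiffOn fun x hx => hx).snd
  have hga : g a = a := by simp [g, hQsa]
  have hi' : HasFDerivAt i (ContinuousLinearMap.inl ℝ E E) a := hasFDerivAt_prodMk_left a 0
  have hQd : HasFDerivAt Q.symm (P'.symm : (E × E) →L[ℝ] E × E) (i a) :=
    Q.hasFDerivAt_symm hat (by rw [hQsa, hQ]; exact hPd)
  have hgd : HasFDerivAt g (L : E →L[ℝ] E) a := by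
    refine (hasFDerivAt_snd.comp a (hQd.comp a hi')).congr_fderiv ?_
    ext x
    change L x - w⁻¹ • (0 : E) = L x
    simp
  have key : ∀ x ∈ O', Q.symm (x, 0) = (x, g x) ∧ K (x, g x) = 0 := by
    intro x hx
    have h1 := Q.right_inv hx
    rw [hQ] at h1
    have h2 : (Q.symm (x, 0)).1 = x := congrArg Prod.fst h1
    have h3 : Q.symm (x, 0) = (x, g x) := Prod.ext h2 rfl
    refine ⟨h3, ?_⟩
    rw [← h3]
    exact congrArg Prod.snd h1
  -- The implicit function `g` has the invertible derivative `L` at `a`, so a second inversion makes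
  -- it a local diffeomorphism.
  obtain ⟨e, hae, heO, he, hes⟩ := exists_smooth_localInverse hO' hat hg hgd
  refine ⟨e, hae, by rw [he, hga], by rw [he]; exact hg.mono heO, hes, by rw [he]; exact hgd,
    ?_, ?_⟩
  · intro x hx
    rw [he]
    refine ⟨?_, (key x (heO hx)).2⟩
    have h1 := hQO (Q.map_target (heO hx))
    rwa [(key x (heO hx)).1] at h1
  · filter_upwards [Q.open_source.mem_nhds haQ,
      continuousAt_fst.preimage_mem_nhds (e.open_source.mem_nhds hae)] with p hp hp1 hp0
    refine ⟨hp1, ?_⟩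
    have h1 : Q p = (p.1, 0) := by rw [hQ]; simp [P, hp0]
    have h2 : Q.symm (p.1, 0) = p := by rw [← h1, Q.left_inv hp]
    rw [he]
    simp [g, h2]

end InverseFunction

/-! ### Germs of `𝔽`-compatibility along `Y`. -/

section Compatibility

variable {𝔽 : Type*} [RCLike 𝔽] {c m n : ℕ} {X : Type*} [TopologicalSpace X]
  [ChartedSpace (EuclideanSpace ℝ (Fin n)) X] {Y : Set X}
  {φ φ' φ'' : OpenPartialHomeomorph X (LocalModel 𝔽 c m)} {y : X}

/-- Near `y`, the first `c` components of `φ ∘ φ'⁻¹` are `h(r, s) r` for a smooth `h` with values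
in `End_𝔽(𝔽^c)`. -/
def CompatAt (φ φ' : OpenPartialHomeomorph X (LocalModel 𝔽 c m)) (y : X) : Prop :=
  ∃ h : LocalModel 𝔽 c m → (Fin c → 𝔽) →L[𝔽] (Fin c → 𝔽), ∃ V ∈ 𝓝 (φ' y),
    ContDiffOn ℝ ∞ h V ∧ ∀ p ∈ V, (φ (φ'.symm p)).1 = h p p.1

theorem contDiff_clm_comp {E F G H : Type*} [NormedAddCommGroup E] [NormedSpace ℝ E]
    [NormedAddCommGroup F] [NormedSpace 𝔽 F] [NormedSpace ℝ F] [IsScalarTower ℝ 𝔽 F]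
    [NormedAddCommGroup G] [NormedSpace 𝔽 G] [NormedSpace ℝ G] [IsScalarTower ℝ 𝔽 G]
    [NormedAddCommGroup H] [NormedSpace 𝔽 H] [NormedSpace ℝ H] [IsScalarTower ℝ 𝔽 H]
    {g : E → G →L[𝔽] H} {f : E → F →L[𝔽] G} {s : Set E}
    (hg : ContDiffOn ℝ ∞ g s) (hf : ContDiffOn ℝ ∞ f s) :
    ContDiffOn ℝ ∞ (fun x => (g x).comp (f x)) s :=
  ((isBoundedBilinearMap_comp (𝕜 := 𝔽) (E := F) (F := G) (G := H)).contDiff.restrict_scalars ℝ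
    (n := ∞)).comp_contDiffOn (hg.prodMk hf)

theorem CompatAt.trans (h : CompatAt φ φ' y) (h' : CompatAt φ' φ'' y)
    (hc : IsChartFor (n := n) Y φ') (hc' : IsChartFor (n := n) Y φ'')
    (hs : y ∈ φ'.source) (hs' : y ∈ φ''.source) : CompatAt φ φ'' y := by
  obtain ⟨G, V, hV, hG, hGe⟩ := h
  obtain ⟨G', V', hV', hG', hGe'⟩ := h'
  let O := (φ''.symm ≫ₕ φ').source
  have hO : φ'' y ∈ O := by simp [O, hs, hs']
  have hf := hc'.contDiffOn_trans hc
  have hf0 : (φ' ∘ φ''.symm) (φ'' y) = φ' y := by simp [hs']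
  have hfc : ContinuousAt (φ' ∘ φ''.symm) (φ'' y) :=
    hf.continuousOn.continuousAt ((φ''.symm ≫ₕ φ').open_source.mem_nhds hO)
  refine ⟨fun p => (G (φ' (φ''.symm p))).comp (G' p), O ∩ V' ∩ (φ' ∘ φ''.symm) ⁻¹' V,
    Filter.inter_mem (Filter.inter_mem ((φ''.symm ≫ₕ φ').open_source.mem_nhds hO) hV')
      (hfc (hf0.symm ▸ hV)), ?_, ?_⟩
  · exact contDiff_clm_comp (hG.comp (hf.mono fun p hp => hp.1.1) fun p hp => hp.2)
      (hG'.mono fun p hp => hp.1.2)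
  · rintro p ⟨⟨hpO, hpV'⟩, hpV⟩
    have hp : φ''.symm p ∈ φ'.source := by simp [O] at hpO; exact hpO.2
    have := hGe _ hpV
    simp only [Function.comp_apply, φ'.left_inv hp] at this
    rw [this, hGe' p hpV']
    rfl

/-- In the product rule, the term that differentiates `h` is evaluated on `z.1 = 0` and drops out.
Hence on `Y` the operator `h z` is forced to be the normal block of the differential. -/
theorem fst_fderiv_of_fst_eq {h : LocalModel 𝔽 c m → (Fin c → 𝔽) →L[𝔽] (Fin c → 𝔽)}
    {f : LocalModel 𝔽 c m → LocalModel 𝔽 c m} {f' : LocalModel 𝔽 c m →L[ℝ] LocalModel 𝔽 c m}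
    {z : LocalModel 𝔽 c m} (hz : z.1 = 0) (hh : ContDiffAt ℝ ∞ h z) (hf : HasFDerivAt f f' z)
    (he : ∀ᶠ p in 𝓝 z, (f p).1 = h p p.1) (v : LocalModel 𝔽 c m) : (f' v).1 = h z v.1 := by
  have h2 := ((isBoundedBilinearMap_apply (𝕜 := 𝔽) (E := Fin c → 𝔽)
    (F := Fin c → 𝔽)).hasFDerivAt (h z, z.1) |>.restrictScalars ℝ).comp z
    ((hh.differentiableAt (by simp)).hasFDerivAt.prodMk (hasFDerivAt_fst (𝕜 := ℝ) (p := z)))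
  have h3 : HasFDerivAt (fun p => (f p).1) _ z := hf.fst
  have h4 := DFunLike.congr_fun (h3.unique (h2.congr_of_eventuallyEq he)) v
  simp [hz] at h4
  exact h4

theorem IsChartFor.fderiv_trans_comp (h : IsChartFor (n := n) Y φ)
    (h' : IsChartFor (n := n) Y φ') (hs : y ∈ φ.source) (hs' : y ∈ φ'.source)
    (v : LocalModel 𝔽 c m) :
    fderiv ℝ (φ ∘ φ'.symm) (φ' y) (fderiv ℝ (φ' ∘ φ.symm) (φ y) v) = v := by
  have d : DifferentiableAt ℝ (φ' ∘ φ.symm) (φ y) :=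
    ((h.contDiffOn_trans h').contDiffAt ((φ.symm ≫ₕ φ').open_source.mem_nhds
      (by simp [hs, hs']))).differentiableAt (by simp)
  have d' : DifferentiableAt ℝ (φ ∘ φ'.symm) (φ' y) :=
    ((h'.contDiffOn_trans h).contDiffAt ((φ'.symm ≫ₕ φ).open_source.mem_nhds
      (by simp [hs, hs']))).differentiableAt (by simp)
  have e0 : (φ' ∘ φ.symm) (φ y) = φ' y := by simp [hs]
  have hc := HasFDerivAt.comp (φ y) (e0.symm ▸ d'.hasFDerivAt) d.hasFDerivAt
  have hi : (φ ∘ φ'.symm) ∘ (φ' ∘ φ.symm) =ᶠ[𝓝 (φ y)] id := by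
    filter_upwards [(φ.symm ≫ₕ φ').open_source.mem_nhds
      (by simp [hs, hs'] : φ y ∈ (φ.symm ≫ₕ φ').source)] with p hp
    simp at hp
    simp [hp.1, hp.2]
  rw [← e0]
  exact DFunLike.congr_fun (hc.unique ((hasFDerivAt_id _).congr_of_eventuallyEq hi)) v

/-- At a point of `Y` the factor is the normal block of the differential of a diffeomorphism, hence
surjective and so invertible. Invertibility is open and inversion is smooth, so the inverse
operators serve as factor for the reversed transition. -/
theorem CompatAt.symm (h : CompatAt φ φ' y) (hc : IsChartFor (n := n) Y φ)
    (hc' : IsChartFor (n := n) Y φ') (hs : y ∈ φ.source) (hs' : y ∈ φ'.source) (hy : y ∈ Y) :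
    CompatAt φ' φ y := by
  obtain ⟨G, V₀, hV₀, hG, hGe⟩ := h
  obtain ⟨V, hVV, hVo, hyV⟩ := mem_nhds_iff.1 hV₀
  replace hG := hG.mono hVV
  have hO' : φ' y ∈ (φ'.symm ≫ₕ φ).source := by simp [hs, hs']
  have hO : φ y ∈ (φ.symm ≫ₕ φ').source := by simp [hs, hs']
  have hf := hc.contDiffOn_trans hc'
  have hd : DifferentiableAt ℝ (φ ∘ φ'.symm) (φ' y) :=
    ((hc'.contDiffOn_trans hc).contDiffAt
      ((φ'.symm ≫ₕ φ).open_source.mem_nhds hO')).differentiableAt (by simp)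
  have hsurj : Function.Surjective (G (φ' y)) :=
    fun v => ⟨_, by
      rw [← fst_fderiv_of_fst_eq ((hc'.slice y hs').1 hy) (hG.contDiffAt (hVo.mem_nhds hyV))
        hd.hasFDerivAt (Filter.eventually_of_mem hV₀ hGe), hc.fderiv_trans_comp hc' hs hs' (v, 0)]⟩
  have hinj : Function.Injective (G (φ' y)) :=
    (LinearMap.injective_iff_surjective (f := (G (φ' y)).toLinearMap)).2 hsurj
  have hR : G (φ' y) ∈ range ((↑) : ((Fin c → 𝔽) ≃L[𝔽] (Fin c → 𝔽)) → _ →L[𝔽] _) :=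
    ⟨(LinearEquiv.ofBijective (G (φ' y)).toLinearMap ⟨hinj, hsurj⟩).toContinuousLinearEquiv,
      by ext; rfl⟩
  let V' : Set (LocalModel 𝔽 c m) := V ∩ G ⁻¹' range ((↑) : ((Fin c → 𝔽) ≃L[𝔽] (Fin c → 𝔽)) → _)
  have hV'o : IsOpen V' := hG.continuousOn.isOpen_inter_preimage hVo ContinuousLinearEquiv.isOpen
  have hinv : ContDiffOn ℝ ∞ (fun p => ContinuousLinearMap.inverse (G p)) V' := by
    rintro p ⟨hp, T, hT⟩
    have h1 : ContDiffAt ℝ ∞ (ContinuousLinearMap.inverse :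
        ((Fin c → 𝔽) →L[𝔽] (Fin c → 𝔽)) → _) (G p) := by
      rw [← hT]
      exact (contDiffAt_map_inverse (𝕜 := 𝔽) (n := ∞) T).restrict_scalars ℝ
    exact (h1.comp p (hG.contDiffAt (hVo.mem_nhds hp))).contDiffWithinAt
  have hfc : ContinuousAt (φ' ∘ φ.symm) (φ y) :=
    hf.continuousOn.continuousAt ((φ.symm ≫ₕ φ').open_source.mem_nhds hO)
  have hf0 : (φ' ∘ φ.symm) (φ y) = φ' y := by simp [hs]
  refine ⟨fun p => ContinuousLinearMap.inverse (G (φ' (φ.symm p))),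
    (φ.symm ≫ₕ φ').source ∩ (φ' ∘ φ.symm) ⁻¹' V', Filter.inter_mem
      ((φ.symm ≫ₕ φ').open_source.mem_nhds hO)
      (hfc (hf0.symm ▸ hV'o.mem_nhds ⟨hyV, hR⟩)), ?_, ?_⟩
  · exact hinv.comp (hf.mono fun p hp => hp.1) fun p hp => hp.2
  · rintro p ⟨hp, hpV, T, hT⟩
    simp only [OpenPartialHomeomorph.trans_source, OpenPartialHomeomorph.symm_source,
      mem_inter_iff, mem_preimage] at hp
    have := hGe _ (hVV hpV)
    simp only [Function.comp_apply, φ'.left_inv hp.2, φ.right_inv hp.1] at this hT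
    rw [← hT] at this
    simp only [← hT]
    rw [this, ContinuousLinearMap.inverse_equiv]
    simp

/-- The condition on the operator at each point is affine, so local smooth solutions can be patched
by a partition of unity. Near `Y` they are given by the hypothesis; away from `Y` a solution always
exists. -/
theorem exists_contDiffOn_fst_eq (hc : IsChartFor (n := n) Y φ) (hc' : IsChartFor (n := n) Y φ')
    (h : ∀ y ∈ Y, y ∈ φ.source → y ∈ φ'.source → CompatAt φ φ' y) :
    ∃ h : LocalModel 𝔽 c m → (Fin c → 𝔽) →L[𝔽] (Fin c → 𝔽),
      ContDiffOn ℝ ∞ h (φ' '' (φ.source ∩ φ'.source)) ∧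
      ∀ p ∈ φ' '' (φ.source ∩ φ'.source), (φ (φ'.symm p)).1 = h p p.1 := by
  have himg : φ' '' (φ.source ∩ φ'.source) = (φ'.symm ≫ₕ φ).source := by
    ext p
    constructor
    · rintro ⟨x, ⟨h1, h2⟩, rfl⟩
      simp [h1, h2]
    · intro hp
      simp at hp
      exact ⟨φ'.symm p, ⟨hp.2, φ'.map_target hp.1⟩, φ'.right_inv hp.1⟩
  rw [himg]
  let O : TopologicalSpace.Opens (LocalModel 𝔽 c m) := ⟨_, (φ'.symm ≫ₕ φ).open_source⟩
  have hfin : FiniteDimensional ℝ (LocalModel 𝔽 c m) := inferInstance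
  have : SecondCountableTopology (LocalModel 𝔽 c m) := inferInstance
  have hlc : LocallyCompactSpace O := O.isOpen.locallyCompactSpace
  have hsc : SigmaCompactSpace O := inferInstance
  have hex := exists_contMDiffMap_forall_mem_convex_of_local (n := ⊤)
    𝓘(ℝ, LocalModel 𝔽 c m) (M := O) (F := (Fin c → 𝔽) →L[𝔽] (Fin c → 𝔽))
    (t := fun p => {T | (φ (φ'.symm p)).1 = T p.1.1}) ?_ ?_
  · classical
    obtain ⟨g, hg⟩ := hex
    refine ⟨fun p => if hp : p ∈ O then g ⟨p, hp⟩ else 0, ?_, ?_⟩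
    · intro p hp
      have h1 : ContMDiffAt 𝓘(ℝ, LocalModel 𝔽 c m) 𝓘(ℝ, (Fin c → 𝔽) →L[𝔽] (Fin c → 𝔽)) ∞
          (fun p : LocalModel 𝔽 c m => if hp : p ∈ O then g ⟨p, hp⟩ else 0) p := by
        refine (contMDiffAt_subtype_iff (U := O) (x := ⟨p, hp⟩)).1 ?_
        exact (g.contMDiff ⟨p, hp⟩).congr_of_eventuallyEq
          (Filter.Eventually.of_forall fun q => by simp)
      exact h1.contDiffAt.contDiffWithinAt
    · intro p hp
      have hp' : p ∈ O := hp
      simpa [hp'] using hg ⟨p, hp⟩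
  · intro p T hT T' hT' a b ha hb hab
    simp only [mem_ofPred_eq] at hT hT' ⊢
    simp only [_root_.add_apply, _root_.smul_apply, ← hT, ← hT',
      ← add_smul, hab, one_smul]
  · rintro ⟨p, hp⟩
    have hp' : p ∈ φ'.target ∧ φ'.symm p ∈ φ.source := by simpa [O] using hp
    suffices ∃ V ∈ 𝓝 p, ∃ G : LocalModel 𝔽 c m → (Fin c → 𝔽) →L[𝔽] (Fin c → 𝔽),
        ContDiffOn ℝ ∞ G V ∧ ∀ q ∈ V, (φ (φ'.symm q)).1 = G q q.1 by
      obtain ⟨V, hV, G, hG, hGe⟩ := this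
      refine ⟨Subtype.val ⁻¹' V, continuous_subtype_val.continuousAt.preimage_mem_nhds hV,
        fun q => G q, ?_, fun q hq => hGe q hq⟩
      exact hG.contMDiffOn.comp contMDiff_subtype_val.contMDiffOn fun q hq => hq
    by_cases h0 : p.1 = 0
    · have hyY : φ'.symm p ∈ Y := by
        rw [hc'.slice _ (φ'.map_target hp'.1), φ'.right_inv hp'.1, h0]
      obtain ⟨G, V, hV, hG⟩ := h _ hyY hp'.2 (φ'.map_target hp'.1)
      rw [φ'.right_inv hp'.1] at hV
      exact ⟨V, hV, G, hG⟩
    -- Off `Y` some coordinate `r_j` is nonzero, and the rank-one operator `v ↦ v_j • (r_j⁻¹ • f)`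
    -- sends `r` to the prescribed value `f`.
    · obtain ⟨j, hj⟩ := Function.ne_iff.1 h0
      have hne : IsOpen {q : LocalModel 𝔽 c m | q.1 j ≠ 0} :=
        isOpen_ne_fun (by fun_prop) continuous_const
      have hf := hc'.contDiffOn_trans hc
      let S := (ContinuousLinearMap.smulRightL 𝔽 (Fin c → 𝔽) (Fin c → 𝔽)
        (ContinuousLinearMap.proj j)).restrictScalars ℝ
      refine ⟨_, ((φ'.symm ≫ₕ φ).open_source.inter hne).mem_nhds ⟨hp, hj⟩,
        fun q => S ((q.1 j)⁻¹ • (φ (φ'.symm q)).1), ?_, ?_⟩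
      · have hinv : ContDiffOn ℝ ∞ (fun q : LocalModel 𝔽 c m => (q.1 j)⁻¹)
            ((φ'.symm ≫ₕ φ).source ∩ {q | q.1 j ≠ 0}) := fun q hq =>
          ((contDiffAt_inv ℝ hq.2).comp q (by fun_prop : ContDiff ℝ ∞
            fun q : LocalModel 𝔽 c m => q.1 j).contDiffAt).contDiffWithinAt
        exact S.contDiff.comp_contDiffOn (hinv.smul (hf.mono inter_subset_left).fst)
      · rintro q ⟨-, hq⟩
        have hq' : q.1 j ≠ 0 := hq
        change _ = q.1 j • ((q.1 j)⁻¹ • (φ (φ'.symm q)).1)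
        rw [smul_smul, mul_inv_cancel₀ hq', one_smul]

end Compatibility

/-! ### Gluing local solutions of one relation. -/

section Gluing

open Classical in
/-- Local homeomorphisms `e y`, for `y ∈ S`, which near `(y, y)` are given by one relation `R`,
glue to an open partial homeomorphism defined on a neighborhood of `S`. -/
theorem exists_glued_homeomorph {X N : Type*} [MetricSpace X] [TopologicalSpace N] {S : Set X}
    (hS : S.Nonempty) {b : N → X} (hb : Continuous b) {R : X → N → Prop}
    (e : S → OpenPartialHomeomorph X N) (hes : ∀ y : S, (y : X) ∈ (e y).source)
    (hey : ∀ y : S, b (e y y) = y) (hR : ∀ y : S, ∀ x ∈ (e y).source, R x (e y x))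
    (hloc : ∀ y : S, ∀ᶠ p in 𝓝 ((y : X), (y : X)), ∀ q, b q = p.2 → R p.1 q →
      p.1 ∈ (e y).source ∧ e y p.1 = q) :
    ∃ Θ : OpenPartialHomeomorph X N, S ⊆ Θ.source ∧ (∀ y : S, Θ =ᶠ[𝓝 (y : X)] e y) ∧
      ∀ x ∈ Θ.source, ∃ y : S, x ∈ (e y).source ∧ Θ =ᶠ[𝓝 x] e y := by
  -- The factor 3 leaves room for the two comparisons below. If pieces around `y₁` and `y₂` meet, in
  -- the source or in the target, and `δ y₂ ≤ δ y₁`, then a path through three distances, each below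
  -- `δ y₁`, puts the data of the second piece in the uniqueness region of the first.
  have hε : ∀ y : S, ∃ δ > 0, ∀ (x : X) q, dist x y < 3 * δ → dist (b q) y < 3 * δ → R x q →
      x ∈ (e y).source ∧ e y x = q := by
    intro y
    obtain ⟨ε, hε, h⟩ := Metric.eventually_nhds_iff_ball.1 (hloc y)
    refine ⟨ε / 3, by positivity, fun x q hx hq hxq => h (x, b q) ?_ q rfl hxq⟩
    rw [Metric.mem_ball, Prod.dist_eq]
    exact max_lt (by linarith) (by change dist (b q) (y : X) < ε; linarith)
  choose δ hδ h using hε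
  let U : S → Set X := fun y =>
    (e y).source ∩ {x | dist x y < δ y} ∩ {x | dist (b (e y x)) y < δ y}
  have hU : ∀ y, IsOpen (U y) := by
    intro y
    have h1 : ContinuousOn (fun x => dist (b (e y x)) (y : X)) (e y).source :=
      (continuous_id.dist continuous_const).comp_continuousOn
        (hb.comp_continuousOn (e y).continuousOn)
    have h2 := h1.isOpen_inter_preimage (e y).open_source (isOpen_Iio (a := δ y))
    have h3 : IsOpen {x : X | dist x y < δ y} := Metric.isOpen_ball
    convert h2.inter h3 using 1
    ext x
    simp only [U, mem_inter_iff, mem_preimage, mem_Iio, mem_ofPred_eq]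
    tauto
  have hyU : ∀ y : S, (y : X) ∈ U y := fun y => ⟨⟨hes y, by simp [hδ]⟩, by simp [hey, hδ]⟩
  have hfun : ∀ y₁ y₂ x, δ y₂ ≤ δ y₁ → x ∈ U y₁ → x ∈ U y₂ → e y₁ x = e y₂ x := by
    rintro y₁ y₂ x hle ⟨⟨h1, h2⟩, h3⟩ ⟨⟨h1', h2'⟩, h3'⟩
    simp only [mem_ofPred_eq] at h2 h3 h2' h3'
    refine (h y₁ x _ ?_ ?_ (hR y₂ x h1')).2
    · linarith [hδ y₁]
    · have t1 := dist_triangle4 (b (e y₂ x)) y₂ x y₁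
      rw [dist_comm (y₂ : X) x] at t1
      linarith
  have hinj : ∀ y₁ y₂ x₁ x₂, δ y₂ ≤ δ y₁ → x₁ ∈ U y₁ → x₂ ∈ U y₂ → e y₁ x₁ = e y₂ x₂ →
      x₁ = x₂ := by
    rintro y₁ y₂ x₁ x₂ hle ⟨⟨h1, h2⟩, h3⟩ ⟨⟨h1', h2'⟩, h3'⟩ he
    simp only [mem_ofPred_eq] at h2 h3 h2' h3'
    obtain ⟨h4, h5⟩ := h y₁ x₂ (e y₂ x₂) (by
      have t1 := dist_triangle4 x₂ y₂ (b (e y₂ x₂)) y₁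
      rw [dist_comm (y₂ : X) (b _)] at t1
      rw [he] at h3
      linarith) (by rw [← he]; linarith [hδ y₁]) (hR y₂ x₂ h1')
    exact (e y₁).injOn h1 h4 (by rw [h5, he])
  let W : Set X := ⋃ y, U y
  have hW : IsOpen W := isOpen_iUnion hU
  let y₀ : S := ⟨_, hS.some_mem⟩
  -- The piece chosen at `x` is immaterial by `hfun`, and the value off `W` is never used.
  let f : X → N := fun x => if hx : ∃ y, x ∈ U y then e hx.choose x else e y₀ y₀
  have hf : ∀ y, EqOn f (e y) (U y) := by
    intro y x hx
    have hx' : ∃ y, x ∈ U y := ⟨y, hx⟩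
    simp only [f, dif_pos hx']
    rcases le_total (δ y) (δ hx'.choose) with hle | hle
    · exact hfun _ _ x hle hx'.choose_spec hx
    · exact (hfun _ _ x hle hx hx'.choose_spec).symm
  have hfe : ∀ y, ∀ x ∈ U y, f =ᶠ[𝓝 x] e y := fun y x hx =>
    Filter.eventually_of_mem ((hU y).mem_nhds hx) (hf y)
  have hfi : InjOn f W := by
    intro x₁ h₁ x₂ h₂ h12
    obtain ⟨y₁, h₁⟩ := mem_iUnion.1 h₁
    obtain ⟨y₂, h₂⟩ := mem_iUnion.1 h₂
    rw [hf y₁ h₁, hf y₂ h₂] at h12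
    rcases le_total (δ y₂) (δ y₁) with hle | hle
    · exact hinj _ _ _ _ hle h₁ h₂ h12
    · exact (hinj _ _ _ _ hle h₂ h₁ h12.symm).symm
  have hne : Nonempty X := ⟨hS.some⟩
  have hfc : ContinuousOn f W := by
    intro x hx
    obtain ⟨y, hy⟩ := mem_iUnion.1 hx
    exact (((e y).continuousAt hy.1.1).congr (hfe y x hy).symm).continuousWithinAt
  have hfo : IsOpenMap (W.domRestrict f) := by
    rw [isOpenMap_iff_nhds_le]
    rintro ⟨x, hx⟩
    obtain ⟨y, hy⟩ := mem_iUnion.1 hx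
    have h1 : Filter.map f (𝓝 x) = 𝓝 (f x) := by
      rw [Filter.map_congr (hfe y x hy), (e y).map_nhds_eq hy.1.1, hf y hy]
    rw [domRestrict_eq, ← Filter.map_map, map_nhds_subtype_coe_eq_nhds hx (hW.mem_nhds hx)]
    exact h1.ge
  let Θ := OpenPartialHomeomorph.ofContinuousOpenRestrict (hfi.bijOn_image.toPartialEquiv f W _)
    hfc hfo hW
  exact ⟨Θ, fun y hy => mem_iUnion.2 ⟨⟨y, hy⟩, hyU ⟨y, hy⟩⟩, fun y => hfe y y (hyU y),
    fun x hx => let ⟨y, hy⟩ := mem_iUnion.1 hx; ⟨y, hy.1.1, hfe y x hy⟩⟩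

end Gluing

/-! ### The averaged relation in coordinates and its linearization. -/

section Relation

variable {𝔽 : Type*} [RCLike 𝔽] {c m n : ℕ} {X : Type*} [TopologicalSpace X]
  [ChartedSpace (EuclideanSpace ℝ (Fin n)) X] {Y : Set X}
  {φ β : OpenPartialHomeomorph X (LocalModel 𝔽 c m)} {y : X}

theorem hasFDerivAt_clm_apply_of_eq_zero {E F G : Type*} [NormedAddCommGroup E]
    [NormedSpace ℝ E] [NormedAddCommGroup F] [NormedSpace ℝ F] [NormedAddCommGroup G]
    [NormedSpace ℝ G] {B : E → F →L[ℝ] G} {u : E → F} {u' : E →L[ℝ] F} {p : E}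
    (hB : DifferentiableAt ℝ B p) (hu : HasFDerivAt u u' p) (h0 : u p = 0) :
    HasFDerivAt (fun q => B q (u q)) ((B p).comp u') p :=
  (hB.hasFDerivAt.clm_apply hu).congr_fderiv (by ext v; simp [h0])

/-- The transition map carries the slice `r = 0` into itself, so its differential is block
triangular along `Y`. -/
theorem IsChartFor.fderiv_trans_tangent (h : IsChartFor (n := n) Y β)
    (h' : IsChartFor (n := n) Y φ) (hs : y ∈ β.source) (hs' : y ∈ φ.source) (hy : y ∈ Y)
    (s : Fin m → ℝ) :
    (fderiv ℝ (φ ∘ β.symm) (β y) ((0, s) : LocalModel 𝔽 c m)).1 = 0 := by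
  have hmem : β y ∈ (β.symm ≫ₕ φ).source := by simp [hs, hs']
  have hnhds := (β.symm ≫ₕ φ).open_source.mem_nhds hmem
  have d : DifferentiableAt ℝ (φ ∘ β.symm) (β y) :=
    ((h.contDiffOn_trans h').contDiffAt hnhds).differentiableAt (by simp)
  have hβ := h.apply_eq hs hy
  let i : (Fin m → ℝ) → LocalModel 𝔽 c m := fun t => (0, t)
  have hi : HasFDerivAt i (ContinuousLinearMap.inr ℝ (Fin c → 𝔽) (Fin m → ℝ)) (β y).2 :=
    hasFDerivAt_prodMk_right 0 _
  have hiβ : i (β y).2 = β y := hβ.symm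
  have hc := HasFDerivAt.fst (HasFDerivAt.comp (β y).2 (hiβ.symm ▸ d.hasFDerivAt) hi)
  have he : (fun t => ((φ ∘ β.symm) (i t)).1) =ᶠ[𝓝 (β y).2] fun _ => 0 := by
    filter_upwards [hi.continuousAt.preimage_mem_nhds (hiβ.symm ▸ hnhds)] with t ht
    simp only [mem_preimage, OpenPartialHomeomorph.trans_source,
      OpenPartialHomeomorph.symm_source, mem_inter_iff] at ht
    exact (h'.slice _ ht.2).1 (h.symm_mem ht.1)
  have := DFunLike.congr_fun (hc.unique ((hasFDerivAt_const _ _).congr_of_eventuallyEq he)) s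
  rw [← hiβ]
  exact this

/-- The differential `d(β ∘ φ⁻¹)` at the point of `Y` with `β`-coordinates `(0, t)`. -/
def transDeriv (φ β : OpenPartialHomeomorph X (LocalModel 𝔽 c m)) (t : Fin m → ℝ) :
    LocalModel 𝔽 c m →L[ℝ] LocalModel 𝔽 c m :=
  fderiv ℝ (β ∘ φ.symm) (φ (β.symm (0, t)))

/-- The contribution of the chart `φ` to the relation between the `β`-coordinates of a point of
`X` and of a normal vector. -/
def relTerm (φ β : OpenPartialHomeomorph X (LocalModel 𝔽 c m))
    (p : LocalModel 𝔽 c m × LocalModel 𝔽 c m) : LocalModel 𝔽 c m :=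
  ((transDeriv φ β p.2.2 ((φ (β.symm p.1)).1, 0)).1 - p.2.1,
    (transDeriv φ β p.2.2 (0, (φ (β.symm p.1)).2 - (φ (β.symm (0, p.2.2))).2)).2)

/-- The domain of `relTerm`. -/
def relDomain (φ β : OpenPartialHomeomorph X (LocalModel 𝔽 c m)) :
    Set (LocalModel 𝔽 c m × LocalModel 𝔽 c m) :=
  {p | p.1 ∈ (β.symm ≫ₕ φ).source ∧ ((0, p.2.2) : LocalModel 𝔽 c m) ∈ (β.symm ≫ₕ φ).source}

theorem contDiff_zero_snd : ContDiff ℝ ∞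
    fun p : LocalModel 𝔽 c m × LocalModel 𝔽 c m => ((0, p.2.2) : LocalModel 𝔽 c m) := by
  fun_prop

theorem isOpen_relDomain (φ β : OpenPartialHomeomorph X (LocalModel 𝔽 c m)) :
    IsOpen (relDomain φ β) :=
  ((β.symm ≫ₕ φ).open_source.preimage continuous_fst).inter
    ((β.symm ≫ₕ φ).open_source.preimage contDiff_zero_snd.continuous)

theorem IsChartFor.contDiffOn_transDeriv (h : IsChartFor (n := n) Y β)
    (h' : IsChartFor (n := n) Y φ) : ContDiffOn ℝ ∞ (transDeriv φ β)
      {t | ((0, t) : LocalModel 𝔽 c m) ∈ (β.symm ≫ₕ φ).source} := by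
  have h1 := (h'.contDiffOn_trans h).fderiv_of_isOpen (m := ∞) (φ.symm ≫ₕ β).open_source
    (by simp)
  have h2 : ContDiffOn ℝ ∞ (fun t : Fin m → ℝ => (φ ∘ β.symm) ((0, t) : LocalModel 𝔽 c m))
      {t | ((0, t) : LocalModel 𝔽 c m) ∈ (β.symm ≫ₕ φ).source} :=
    (h.contDiffOn_trans h').comp (by fun_prop : ContDiff ℝ ∞
      fun t : Fin m → ℝ => ((0, t) : LocalModel 𝔽 c m)).contDiffOn fun t ht => ht
  refine h1.comp h2 fun t ht => ?_
  simp only [OpenPartialHomeomorph.trans_source, OpenPartialHomeomorph.symm_source,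
    mem_inter_iff, mem_preimage, mem_ofPred_eq] at ht
  simp [ht.1, ht.2]

theorem IsChartFor.contDiffOn_relTerm (h : IsChartFor (n := n) Y β)
    (h' : IsChartFor (n := n) Y φ) : ContDiffOn ℝ ∞ (relTerm φ β) (relDomain φ β) := by
  have hf := h.contDiffOn_trans h'
  have h1 : ContDiffOn ℝ ∞ (fun p : LocalModel 𝔽 c m × LocalModel 𝔽 c m =>
      transDeriv φ β p.2.2) (relDomain φ β) :=
    (h.contDiffOn_transDeriv h').comp (by fun_prop : ContDiff ℝ ∞
      fun p : LocalModel 𝔽 c m × LocalModel 𝔽 c m => p.2.2).contDiffOn fun p hp => hp.2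
  have h2 : ContDiffOn ℝ ∞ (fun p : LocalModel 𝔽 c m × LocalModel 𝔽 c m =>
      (φ ∘ β.symm) p.1) (relDomain φ β) := hf.comp contDiff_fst.contDiffOn fun p hp => hp.1
  have h3 : ContDiffOn ℝ ∞ (fun p : LocalModel 𝔽 c m × LocalModel 𝔽 c m =>
      (φ ∘ β.symm) (0, p.2.2)) (relDomain φ β) :=
    hf.comp contDiff_zero_snd.contDiffOn fun p hp => hp.2
  refine ContDiffOn.prodMk (ContDiffOn.sub ?_ (by fun_prop : ContDiff ℝ ∞
    fun p : LocalModel 𝔽 c m × LocalModel 𝔽 c m => p.2.1).contDiffOn) ?_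
  · exact (h1.clm_apply (h2.fst.prodMk contDiffOn_const)).fst
  · exact (h1.clm_apply (contDiffOn_const.prodMk (h2.snd.sub h3.snd))).snd

theorem IsChartFor.relTerm_self (h : IsChartFor (n := n) Y β) (h' : IsChartFor (n := n) Y φ)
    (hs : y ∈ β.source) (hs' : y ∈ φ.source) (hy : y ∈ Y) : relTerm φ β (β y, β y) = 0 := by
  have e : ((0, (β y).2) : LocalModel 𝔽 c m) = β y := (h.apply_eq hs hy).symm
  have e1 : (β y).1 = 0 := (h.slice y hs).1 hy
  have e2 : (φ y).1 = 0 := (h'.slice y hs').1 hy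
  simp only [relTerm, e, β.left_inv hs, e1, e2, sub_self]
  have : ((0, 0) : LocalModel 𝔽 c m) = 0 := rfl
  simp [this]

/-- The differentials of the two transition maps at `y` are mutually inverse and both preserve the
tangential subspace. Their diagonal blocks therefore cancel, and the only trace of the chart `φ` is
the off-diagonal block `M`. Variation of `transDeriv` does not contribute because its argument
vanishes at the base point. -/
theorem IsChartFor.hasFDerivAt_relTerm (h : IsChartFor (n := n) Y β)
    (h' : IsChartFor (n := n) Y φ) (hs : y ∈ β.source) (hs' : y ∈ φ.source) (hy : y ∈ Y) :
    ∃ M : (Fin c → 𝔽) →L[ℝ] (Fin m → ℝ),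
    ∃ D : LocalModel 𝔽 c m × LocalModel 𝔽 c m →L[ℝ] LocalModel 𝔽 c m,
      HasFDerivAt (relTerm φ β) D (β y, β y) ∧
      ∀ p, D p = (p.1.1 - p.2.1, p.1.2 - p.2.2 + M p.1.1) := by
  have e : ((0, (β y).2) : LocalModel 𝔽 c m) = β y := (h.apply_eq hs hy).symm
  have e2 : (φ y).1 = 0 := (h'.slice y hs').1 hy
  have hmem : β y ∈ (β.symm ≫ₕ φ).source := by simp [hs, hs']
  have hnhds := (β.symm ≫ₕ φ).open_source.mem_nhds hmem
  have d : HasFDerivAt (φ ∘ β.symm) (fderiv ℝ (φ ∘ β.symm) (β y)) (β y) :=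
    (((h.contDiffOn_trans h').contDiffAt hnhds).differentiableAt (by simp)).hasFDerivAt
  set T := fderiv ℝ (φ ∘ β.symm) (β y) with hT
  set S := transDeriv φ β (β y).2 with hS
  have hSdef : S = fderiv ℝ (β ∘ φ.symm) (φ y) := by
    rw [hS, transDeriv, e, β.left_inv hs]
  have hST : ∀ v, S (T v) = v := by
    intro v
    rw [hSdef, hT]
    exact h.fderiv_trans_comp h' hs hs' v
  have hS0 : ∀ s, (S ((0, s) : LocalModel 𝔽 c m)).1 = 0 := by
    intro s
    rw [hSdef]
    exact h'.fderiv_trans_tangent h hs' hs hy s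
  have hT0 : ∀ s, (T ((0, s) : LocalModel 𝔽 c m)).1 = 0 :=
    fun s => h.fderiv_trans_tangent h' hs hs' hy s
  let p₁ : LocalModel 𝔽 c m × LocalModel 𝔽 c m →L[ℝ] LocalModel 𝔽 c m :=
    ContinuousLinearMap.fst ℝ _ _
  let q₁ : LocalModel 𝔽 c m →L[ℝ] (Fin c → 𝔽) := ContinuousLinearMap.fst ℝ _ _
  let q₂ : LocalModel 𝔽 c m →L[ℝ] (Fin m → ℝ) := ContinuousLinearMap.snd ℝ _ _
  let p₂ : LocalModel 𝔽 c m × LocalModel 𝔽 c m →L[ℝ] LocalModel 𝔽 c m :=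
    ContinuousLinearMap.snd ℝ _ _
  let i₁ : (Fin c → 𝔽) →L[ℝ] LocalModel 𝔽 c m := ContinuousLinearMap.inl ℝ _ _
  let i₂ : (Fin m → ℝ) →L[ℝ] LocalModel 𝔽 c m := ContinuousLinearMap.inr ℝ _ _
  have hB : DifferentiableAt ℝ (fun p : LocalModel 𝔽 c m × LocalModel 𝔽 c m => transDeriv φ β p.2.2)
      (β y, β y) := by
    have ho : IsOpen {t : Fin m → ℝ | ((0, t) : LocalModel 𝔽 c m) ∈ (β.symm ≫ₕ φ).source} :=
      (β.symm ≫ₕ φ).open_source.preimage (by fun_prop)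
    have h1 := ((h.contDiffOn_transDeriv h').contDiffAt (x := (β y).2) (ho.mem_nhds
      (by change _ ∈ (β.symm ≫ₕ φ).source; rw [e]; exact hmem))).differentiableAt (by simp)
    exact DifferentiableAt.comp (β y, β y) (g := transDeriv φ β)
      (f := fun p : LocalModel 𝔽 c m × LocalModel 𝔽 c m => p.2.2) h1 (by fun_prop)
  have h1 : HasFDerivAt (fun p : LocalModel 𝔽 c m × LocalModel 𝔽 c m => (φ ∘ β.symm) p.1)
      (T.comp p₁) (β y, β y) :=
    HasFDerivAt.comp (β y, β y) (f := fun p : LocalModel 𝔽 c m × LocalModel 𝔽 c m => p.1) d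
      hasFDerivAt_fst
  have h2 : HasFDerivAt (fun p : LocalModel 𝔽 c m × LocalModel 𝔽 c m => (φ ∘ β.symm) (0, p.2.2))
      (T.comp (i₂.comp (q₂.comp p₂))) (β y, β y) :=
    HasFDerivAt.comp (β y, β y)
      (f := fun p : LocalModel 𝔽 c m × LocalModel 𝔽 c m => ((0, p.2.2) : LocalModel 𝔽 c m))
      (by simpa [e] using d)
      (i₂.comp (q₂.comp p₂)).hasFDerivAt
  have h3 := hasFDerivAt_clm_apply_of_eq_zero hB
    (i₁.hasFDerivAt.comp (β y, β y) h1.fst) (by simp [i₁, hs, e2])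
  have h4 := hasFDerivAt_clm_apply_of_eq_zero hB
    (i₂.hasFDerivAt.comp (β y, β y) (h1.snd.sub h2.snd)) (by simp [i₂, hs, e])
  have h5 := (h3.fst.sub (q₁.comp p₂).hasFDerivAt).prodMk h4.snd
  -- `M` comes from splitting `T a` into its normal and tangential parts: `S` applied to the
  -- tangential part is `a` minus `S` of the normal part, whose tangential component is the
  -- correction.
  refine ⟨-(q₂.comp (S.comp (i₁.comp (q₁.comp (T.comp i₁))))), _, h5, ?_⟩
  rintro ⟨a, b⟩
  have ha1 : (T a).1 = (T ((a.1, 0) : LocalModel 𝔽 c m)).1 := by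
    have : a = ((a.1, 0) : LocalModel 𝔽 c m) + ((0, a.2) : LocalModel 𝔽 c m) := by ext <;> simp
    conv_lhs => rw [this, map_add, Prod.fst_add, hT0, add_zero]
  have k1 : S ((T a).1, 0) = a - S (0, (T a).2) := by
    rw [eq_sub_iff_add_eq, ← map_add, Prod.mk_add_mk, zero_add, add_zero]
    exact hST a
  have k2 : S (0, (T a).2 - (T (0, b.2)).2) = a - (0, b.2) - S ((T a).1, 0) := by
    rw [eq_sub_iff_add_eq, ← map_add, Prod.mk_add_mk, zero_add, add_zero]
    conv_rhs => rw [← hST a, ← hST (0, b.2), ← map_sub]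
    congr 1
    refine Prod.ext ?_ rfl
    change _ = (T a).1 - (T (0, b.2)).1
    rw [hT0, sub_zero]
  refine Prod.ext ?_ ?_
  · change (S ((T a).1, 0)).1 - b.1 = a.1 - b.1
    rw [k1, Prod.fst_sub, hS0, sub_zero]
  · change (S (0, (T a).2 - (T (0, b.2)).2)).2 =
      a.2 - b.2 + -(S ((T ((a.1, 0) : LocalModel 𝔽 c m)).1, 0)).2
    rw [k2, ← ha1, Prod.snd_sub, Prod.snd_sub, ← sub_eq_add_neg]

variable {ι : Type*} (J : Finset ι) (ρ : ι → X → ℝ)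
  (ψ : ι → OpenPartialHomeomorph X (LocalModel 𝔽 c m))

/-- The weight of the `i`-th chart. -/
def relWeight (β : OpenPartialHomeomorph X (LocalModel 𝔽 c m)) (i : ι)
    (p : LocalModel 𝔽 c m × LocalModel 𝔽 c m) : ℝ :=
  ρ i (β.symm p.1) * ρ i (β.symm (0, p.2.2))

/-- The function whose zeros are the pairs of coordinates of related points of `X` and normal
vectors. -/
def relFun (β : OpenPartialHomeomorph X (LocalModel 𝔽 c m))
    (p : LocalModel 𝔽 c m × LocalModel 𝔽 c m) : LocalModel 𝔽 c m :=
  ∑ i ∈ J, relWeight ρ β i p • relTerm (ψ i) β p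

/-- The total weight. -/
def relTotal (β : OpenPartialHomeomorph X (LocalModel 𝔽 c m))
    (p : LocalModel 𝔽 c m × LocalModel 𝔽 c m) : ℝ :=
  ∑ i ∈ J, relWeight ρ β i p

variable {J ρ ψ}

theorem IsChartFor.contDiffOn_relWeight (h : IsChartFor (n := n) Y β) {i : ι}
    (hρ : ContMDiff 𝓘(ℝ, EuclideanSpace ℝ (Fin n)) 𝓘(ℝ, ℝ) ∞ (ρ i)) :
    ContDiffOn ℝ ∞ (relWeight ρ β i)
      {p | p.1 ∈ β.target ∧ ((0, p.2.2) : LocalModel 𝔽 c m) ∈ β.target} := by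
  have h1 : ContDiffOn ℝ ∞ (ρ i ∘ β.symm) β.target :=
    (hρ.comp_contMDiffOn h.smooth_symm).contDiffOn
  exact (h1.comp contDiff_fst.contDiffOn fun p hp => hp.1).mul
    (h1.comp contDiff_zero_snd.contDiffOn fun p hp => hp.2)

theorem isOpen_weightDomain (β : OpenPartialHomeomorph X (LocalModel 𝔽 c m)) :
    IsOpen {p : LocalModel 𝔽 c m × LocalModel 𝔽 c m |
      p.1 ∈ β.target ∧ ((0, p.2.2) : LocalModel 𝔽 c m) ∈ β.target} :=
  (β.open_target.preimage continuous_fst).inter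
    (β.open_target.preimage contDiff_zero_snd.continuous)

/-- Each term vanishes at the diagonal point, so derivatives of the weights disappear. A weighted
mean of shears with identity diagonal blocks is again such a shear, and is invertible however far
apart the charts are. -/
theorem IsChartFor.hasFDerivAt_relFun (h : IsChartFor (n := n) Y β)
    (hψ : ∀ i ∈ J, IsChartFor (n := n) Y (ψ i)) (hs : y ∈ β.source)
    (hs' : ∀ i ∈ J, y ∈ (ψ i).source) (hy : y ∈ Y)
    (hρ : ∀ i, ContMDiff 𝓘(ℝ, EuclideanSpace ℝ (Fin n)) 𝓘(ℝ, ℝ) ∞ (ρ i))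
    (hw : relTotal J ρ β (β y, β y) ≠ 0) :
    ∃ L : LocalModel 𝔽 c m ≃L[ℝ] LocalModel 𝔽 c m, (∀ v, (L v).1 = v.1) ∧
    ∃ D : LocalModel 𝔽 c m × LocalModel 𝔽 c m →L[ℝ] LocalModel 𝔽 c m,
      HasFDerivAt (relFun J ρ ψ β) D (β y, β y) ∧
      ∀ p, D p = relTotal J ρ β (β y, β y) • (L p.1 - p.2) := by
  classical
  set z := (β y, β y) with hz
  have hβ : ((0, (β y).2) : LocalModel 𝔽 c m) = β y := (h.apply_eq hs hy).symm
  have key : ∀ i : ι, ∃ M : (Fin c → 𝔽) →L[ℝ] (Fin m → ℝ),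
      ∃ D : LocalModel 𝔽 c m × LocalModel 𝔽 c m →L[ℝ] LocalModel 𝔽 c m, i ∈ J →
      HasFDerivAt (relTerm (ψ i) β) D z ∧
      ∀ p, D p = (p.1.1 - p.2.1, p.1.2 - p.2.2 + M p.1.1) := by
    intro i
    by_cases hi : i ∈ J
    · obtain ⟨M, D, h1⟩ := h.hasFDerivAt_relTerm (hψ i hi) hs (hs' i hi) hy
      exact ⟨M, D, fun _ => h1⟩
    · exact ⟨0, 0, fun h => absurd h hi⟩
  choose M D hD using key
  set w := relTotal J ρ β z with hw'
  let N : (Fin c → 𝔽) →L[ℝ] (Fin m → ℝ) := w⁻¹ • ∑ i ∈ J, relWeight ρ β i z • M i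
  let q₁ : LocalModel 𝔽 c m →L[ℝ] (Fin c → 𝔽) := ContinuousLinearMap.fst ℝ _ _
  let q₂ : LocalModel 𝔽 c m →L[ℝ] (Fin m → ℝ) := ContinuousLinearMap.snd ℝ _ _
  let L : LocalModel 𝔽 c m ≃L[ℝ] LocalModel 𝔽 c m := ContinuousLinearEquiv.equivOfInverse
    (q₁.prod (q₂ + N.comp q₁)) (q₁.prod (q₂ - N.comp q₁))
    (fun v => Prod.ext rfl (add_sub_cancel_right v.2 (N v.1)))
    (fun v => Prod.ext rfl (sub_add_cancel v.2 (N v.1)))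
  have hL : ∀ v : LocalModel 𝔽 c m, L v = (v.1, v.2 + N v.1) := fun v => rfl
  have hterm : ∀ i ∈ J, HasFDerivAt (fun p => relWeight ρ β i p • relTerm (ψ i) β p)
      (relWeight ρ β i z • D i) z := by
    intro i hi
    have h1 : DifferentiableAt ℝ (relWeight ρ β i) z :=
      ((h.contDiffOn_relWeight (hρ i)).contDiffAt ((isOpen_weightDomain β).mem_nhds
        ⟨β.map_source hs, by
          change ((0, (β y).2) : LocalModel 𝔽 c m) ∈ _
          rw [hβ]; exact β.map_source hs⟩)).differentiableAt
        (by simp)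
    refine (h1.hasFDerivAt.smul (hD i hi).1).congr_fderiv ?_
    rw [hz, h.relTerm_self (hψ i hi) hs (hs' i hi) hy]
    ext v <;> simp
  refine ⟨L, fun v => rfl, _, HasFDerivAt.fun_sum hterm, fun p => ?_⟩
  have hws : w = ∑ i ∈ J, relWeight ρ β i z := rfl
  have hwN : w • N p.1.1 = ∑ i ∈ J, relWeight ρ β i z • M i p.1.1 := by
    simp only [N, _root_.smul_apply, smul_smul, mul_inv_cancel₀ hw, one_smul,
      _root_.sum_apply]
  rw [_root_.sum_apply, hL]
  have : ∀ i ∈ J, (relWeight ρ β i z • D i) p = relWeight ρ β i z • (p.1 - p.2) +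
      ((0, relWeight ρ β i z • M i p.1.1) : LocalModel 𝔽 c m) := by
    intro i hi
    rw [_root_.smul_apply, (hD i hi).2]
    ext <;> simp
  rw [Finset.sum_congr rfl this, Finset.sum_add_distrib, ← Finset.sum_smul, ← hws]
  refine Prod.ext ?_ ?_
  · simp [Prod.fst_sum]
  · simp only [Prod.snd_add, Prod.snd_sum, Prod.smul_snd, Prod.snd_sub]
    rw [← hwN, ← smul_add]
    congr 1
    abel

end Relation

/-! ### Differentials of charts on fixed model spaces. -/

section Differentials

variable {𝔽 : Type*} [RCLike 𝔽] {c m n : ℕ} {X : Type*} [TopologicalSpace X]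
  [ChartedSpace (EuclideanSpace ℝ (Fin n)) X] {Y : Set X}
  {φ β : OpenPartialHomeomorph X (LocalModel 𝔽 c m)} {y : X}

variable (n) in
/-- The differential at `y` of a chart `φ`. -/
def chartDiff (φ : OpenPartialHomeomorph X (LocalModel 𝔽 c m)) (y : X) :
    EuclideanSpace ℝ (Fin n) →L[ℝ] LocalModel 𝔽 c m :=
  mfderiv 𝓘(ℝ, EuclideanSpace ℝ (Fin n)) 𝓘(ℝ, LocalModel 𝔽 c m) φ y

variable (n) in
/-- The differential at `φ y` of the inverse of a chart `φ`. -/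
def chartLift (φ : OpenPartialHomeomorph X (LocalModel 𝔽 c m)) (y : X) :
    LocalModel 𝔽 c m →L[ℝ] EuclideanSpace ℝ (Fin n) :=
  mfderiv 𝓘(ℝ, LocalModel 𝔽 c m) 𝓘(ℝ, EuclideanSpace ℝ (Fin n)) φ.symm (φ y)

variable (n) in
/-- The class of a tangent vector in the normal space. -/
def normalClass (Y : Set X) (y : X) : EuclideanSpace ℝ (Fin n) →ₗ[ℝ] NormalSpace n Y y :=
  (tangentSub n Y y).mkQ

theorem normalClass_surjective : Function.Surjective (normalClass n Y y) :=
  (tangentSub n Y y).mkQ_surjective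

theorem normalFrame_eq (r : Fin c → 𝔽) :
    normalFrame n Y φ y r = normalClass n Y y (chartLift n φ y (r, 0)) := rfl

theorem IsChartFor.normalCoord_normalClass (h : IsChartFor (n := n) Y φ) (hs : y ∈ φ.source)
    (hy : y ∈ Y) (v : EuclideanSpace ℝ (Fin n)) :
    normalCoord n Y φ y (normalClass n Y y v) = (chartDiff n φ y v).1 :=
  h.normalCoord_mk hs hy v

theorem IsChartFor.normalClass_eq_zero_iff (h : IsChartFor (n := n) Y φ) (hs : y ∈ φ.source)
    (hy : y ∈ Y) (v : EuclideanSpace ℝ (Fin n)) :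
    normalClass n Y y v = 0 ↔ (chartDiff n φ y v).1 = 0 :=
  (Submodule.Quotient.mk_eq_zero _).trans (h.mem_tangentSub_iff hs hy v)

theorem IsChartFor.chartDiff_injective (h : IsChartFor (n := n) Y φ) (hs : y ∈ φ.source) :
    Function.Injective (chartDiff n φ y) := by
  intro u v huv
  have := congrArg (chartLift n φ y) huv
  exact (h.symm_deriv hs u).symm.trans (this.trans (h.symm_deriv hs v))

theorem IsChartFor.chartDiff_chartLift (hβ : IsChartFor (n := n) Y β)
    (hφ : IsChartFor (n := n) Y φ) (hs : y ∈ β.source) (hs' : y ∈ φ.source)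
    (v : LocalModel 𝔽 c m) :
    chartDiff n β y (chartLift n φ y v) = fderiv ℝ (β ∘ φ.symm) (φ y) v := by
  rw [← mfderiv_eq_fderiv, mfderiv_comp (φ y) (I' := 𝓘(ℝ, EuclideanSpace ℝ (Fin n)))
    (by rw [φ.left_inv hs']; exact hβ.mdifferentiable.mdifferentiableAt hs)
    (hφ.mdifferentiable.mdifferentiableAt_symm (φ.map_source hs')), φ.left_inv hs']
  rfl

end Differentials

/-! ### Charts of the normal bundle and the intrinsic relation. -/

namespace ClosedSubmanifold

variable {𝔽 : Type*} [RCLike 𝔽] {c m n : ℕ} {X : Type*} [TopologicalSpace X]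
  [ChartedSpace (EuclideanSpace ℝ (Fin n)) X] {Y : ClosedSubmanifold 𝔽 c m n X}

/-- The chart of the normal bundle induced by a chart for `Y` in `X`. -/
def normalHomeo (φ : OpenPartialHomeomorph X (LocalModel 𝔽 c m))
    (h : IsChartFor (n := n) Y.carrier φ) (p : Y.NormalBundle) :
    OpenPartialHomeomorph Y.NormalBundle (LocalModel 𝔽 c m) :=
  Y.normalBundleCore.openPartialHomeomorph (normalChart φ h p) ⟨φ, h, p, rfl⟩

section

variable {φ : OpenPartialHomeomorph X (LocalModel 𝔽 c m)}
  (h : IsChartFor (n := n) Y.carrier φ) (p : Y.NormalBundle)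

theorem normalHomeo_apply (q : Y.NormalBundle) :
    normalHomeo φ h p q = (normalCoord n Y.carrier φ q.base q.fiber, (φ q.base).2) := rfl

theorem normalHomeo_symm_apply {z : LocalModel 𝔽 c m}
    (hz : ((0, z.2) : LocalModel 𝔽 c m) ∈ φ.target) : (normalHomeo φ h p).symm z =
      ⟨φ.symm (0, z.2), h.symm_mem hz, normalFrame n Y.carrier φ (φ.symm (0, z.2)) z.1⟩ :=
  normalChartInv_eq h p hz

theorem normalHomeo_symm_base {z : LocalModel 𝔽 c m}
    (hz : ((0, z.2) : LocalModel 𝔽 c m) ∈ φ.target) :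
    ((normalHomeo φ h p).symm z).base = φ.symm (0, z.2) := by
  rw [normalHomeo_symm_apply h p hz]

theorem normalHomeo_mem_maximalAtlas :
    normalHomeo φ h p ∈ IsManifold.maximalAtlas 𝓘(ℝ, LocalModel 𝔽 c m) ∞ Y.NormalBundle :=
  IsManifold.subset_maximalAtlas
    (mem_iUnion.2 ⟨normalChart φ h p, mem_iUnion.2 ⟨⟨φ, h, p, rfl⟩, rfl⟩⟩)

theorem contMDiffOn_normalHomeo :
    ContMDiffOn 𝓘(ℝ, LocalModel 𝔽 c m) 𝓘(ℝ, LocalModel 𝔽 c m) ∞ (normalHomeo φ h p)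
      (normalHomeo φ h p).source :=
  contMDiffOn_of_mem_maximalAtlas (normalHomeo_mem_maximalAtlas h p)

theorem contMDiffOn_normalHomeo_symm :
    ContMDiffOn 𝓘(ℝ, LocalModel 𝔽 c m) 𝓘(ℝ, LocalModel 𝔽 c m) ∞ (normalHomeo φ h p).symm
      (normalHomeo φ h p).target :=
  contMDiffOn_symm_of_mem_maximalAtlas (normalHomeo_mem_maximalAtlas h p)

end

theorem continuous_base : Continuous (NormalBundle.base : Y.NormalBundle → X) := by
  refine continuous_iff_continuousAt.2 fun q => ?_
  obtain ⟨φ, h, hs⟩ := Y.exists_chart q.base q.base_mem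
  have hq : q ∈ (normalHomeo φ h q).source := hs
  have hz : ((0, (normalHomeo φ h q q).2) : LocalModel 𝔽 c m) ∈ φ.target :=
    (normalHomeo φ h q).map_source hq
  have h1 : ContinuousAt (fun q' => ((0, (normalHomeo φ h q q').2) : LocalModel 𝔽 c m)) q :=
    continuousAt_const.prodMk
      (continuousAt_snd.comp ((normalHomeo φ h q).continuousAt hq))
  have h2 := ContinuousAt.comp (f := fun q' => ((0, (normalHomeo φ h q q').2) :
    LocalModel 𝔽 c m)) (φ.symm.continuousAt (x := (0, (normalHomeo φ h q q).2)) hz) h1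
  refine h2.congr ?_
  filter_upwards [(normalHomeo φ h q).open_source.mem_nhds hq] with q' hq'
  change φ.symm (0, (φ q'.base).2) = q'.base
  rw [← h.apply_eq hq' q'.base_mem, φ.left_inv hq']

variable {ι : Type*} {J : Finset ι} {ρ : ι → X → ℝ}
  {ψ : ι → OpenPartialHomeomorph X (LocalModel 𝔽 c m)}
  {β : OpenPartialHomeomorph X (LocalModel 𝔽 c m)}

variable (ρ ψ) in
/-- The relation between `x ∈ X` and a normal vector `q` at `y ∈ Y`: the weighted mean over all
charts of the normal components of `x`, seen from `y`, is `q`, and the weighted mean of the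
tangential components vanishes. -/
def IsRelated (x : X) (q : Y.NormalBundle) : Prop :=
  ∑ᶠ i, (ρ i x * ρ i q.base) • normalFrame n Y.carrier (ψ i) q.base (ψ i x).1 =
      (∑ᶠ i, ρ i x * ρ i q.base) • q.fiber ∧
    ∑ᶠ i, (ρ i x * ρ i q.base) •
      chartLift n (ψ i) q.base (0, (ψ i x).2 - (ψ i q.base).2) = 0

/-- `IsRelated` does not mention `β`, while `relFun` lives in `β`-coordinates and is open to
calculus. The normal equation is tested by the normal part of `chartDiff`, the tangential one by its
tangential part. -/
theorem isRelated_iff (h : IsChartFor (n := n) Y.carrier β) (p : Y.NormalBundle)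
    (hψ : ∀ i ∈ J, IsChartFor (n := n) Y.carrier (ψ i)) {x : X} {q : Y.NormalBundle}
    (hx : x ∈ β.source) (hq : q.base ∈ β.source) (hJ : ∀ i ∉ J, ρ i q.base = 0)
    (hJs : ∀ i ∈ J, q.base ∈ (ψ i).source) :
    IsRelated ρ ψ x q ↔ relFun J ρ ψ β (β x, normalHomeo β h p q) = 0 := by
  obtain ⟨y, hy, v⟩ := q
  obtain ⟨u, rfl⟩ := normalClass_surjective v
  simp only at hq hJ hJs
  have hβ : ((0, (β y).2) : LocalModel 𝔽 c m) = β y := (h.apply_eq hq hy).symm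
  have s1 : ∀ {V : Type} [AddCommGroup V] [Module ℝ V] (f : ι → V),
      ∑ᶠ i, (ρ i x * ρ i y) • f i = ∑ i ∈ J, (ρ i x * ρ i y) • f i := by
    intro V _ _ f
    refine finsum_eq_sum_of_support_subset _ fun i hi => ?_
    by_contra hiJ
    exact hi (by simp [hJ i hiJ])
  have s2 : ∑ᶠ i, ρ i x * ρ i y = ∑ i ∈ J, ρ i x * ρ i y := by
    simpa using s1 (fun _ => (1 : ℝ))
  have hT : ∀ i ∈ J, ∀ w, transDeriv (ψ i) β (β y).2 w =
      chartDiff n β y (chartLift n (ψ i) y w) := by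
    intro i hi w
    rw [h.chartDiff_chartLift (hψ i hi) hq (hJs i hi), transDeriv, hβ, β.left_inv hq]
  have hK : relFun J ρ ψ β (β x, normalHomeo β h p ⟨y, hy, normalClass n Y.carrier y u⟩) =
      ((chartDiff n β y (∑ i ∈ J, (ρ i x * ρ i y) • chartLift n (ψ i) y ((ψ i x).1, 0) -
        (∑ i ∈ J, ρ i x * ρ i y) • u)).1,
      (chartDiff n β y (∑ i ∈ J, (ρ i x * ρ i y) •
        chartLift n (ψ i) y (0, (ψ i x).2 - (ψ i y).2))).2) := by
    rw [normalHomeo_apply, h.normalCoord_normalClass hq hy]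
    simp only [relFun, relWeight, relTerm, hβ, β.left_inv hx, β.left_inv hq]
    refine Prod.ext ?_ ?_
    · simp only [Prod.fst_sum, map_sub, map_sum, map_smul, Prod.fst_sub, Prod.smul_fst]
      rw [Finset.sum_smul, ← Finset.sum_sub_distrib]
      exact Finset.sum_congr rfl fun i hi => by rw [hT i hi, smul_sub]
    · simp only [Prod.snd_sum, map_sum, map_smul, Prod.smul_snd]
      exact Finset.sum_congr rfl fun i hi => by rw [hT i hi]
  rw [hK, Prod.mk_eq_zero, ← h.normalClass_eq_zero_iff hq hy, IsRelated, s1, s1, s2, map_sub,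
    map_sum, map_smul, sub_eq_zero]
  simp only [normalFrame_eq, map_smul]
  refine and_congr_right fun _ => ⟨fun h0 => by rw [h0, map_zero]; rfl, fun h0 => ?_⟩
  refine h.chartDiff_injective hq ?_
  rw [map_zero]
  -- The tangential equation is an equation in `T_y X`, but its left side is already tangent to `Y`,
  -- so its normal coordinates vanish automatically.
  refine Prod.ext ?_ h0
  simp only [map_sum, map_smul, Prod.fst_sum, Prod.smul_fst, Prod.fst_zero]
  refine Finset.sum_eq_zero fun i hi => ?_
  rw [h.chartDiff_chartLift (hψ i hi) hq (hJs i hi),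
    (hψ i hi).fderiv_trans_tangent h (hJs i hi) hq hy, smul_zero]

end ClosedSubmanifold

/-! ### Domains of the relation and linearity of its solutions. -/

section LocalSolution

variable {𝔽 : Type*} [RCLike 𝔽] {c m n : ℕ} {X : Type*} [TopologicalSpace X]
  [ChartedSpace (EuclideanSpace ℝ (Fin n)) X] {Y : Set X}
  {φ β : OpenPartialHomeomorph X (LocalModel 𝔽 c m)} {y : X}
  {ι : Type*} {J : Finset ι} {ρ : ι → X → ℝ}
  {ψ : ι → OpenPartialHomeomorph X (LocalModel 𝔽 c m)}

/-- The fiber coordinate enters the normal equation only through the total weight, so once that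
weight is nonzero the vector is an explicit function of the point `x` and the foot point. -/
theorem relFun_fst (p : LocalModel 𝔽 c m × LocalModel 𝔽 c m) :
    (relFun J ρ ψ β p).1 = (relFun J ρ ψ β (p.1, (0, p.2.2))).1 - relTotal J ρ β p • p.2.1 := by
  simp only [relFun, relTotal, Prod.fst_sum, Prod.smul_fst]
  rw [Finset.sum_smul, ← Finset.sum_sub_distrib]
  refine Finset.sum_congr rfl fun i _ => ?_
  simp only [relTerm, relWeight, sub_zero, smul_sub]

/-- On the diagonal the total weight is a sum of squares of the `ρ i`, hence positive there and
nonzero nearby. Keeping the foot point in `V` is what later ensures that only charts in `J`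
contribute. -/
theorem exists_relFun_domain (h : IsChartFor (n := n) Y β)
    (hψ : ∀ i ∈ J, IsChartFor (n := n) Y (ψ i)) (hs : y ∈ β.source)
    (hs' : ∀ i ∈ J, y ∈ (ψ i).source) (hy : y ∈ Y)
    (hρ : ∀ i, ContMDiff 𝓘(ℝ, EuclideanSpace ℝ (Fin n)) 𝓘(ℝ, ℝ) ∞ (ρ i))
    (hw : ∃ i ∈ J, ρ i y ≠ 0) {V : Set X} (hV : IsOpen V) (hyV : y ∈ V) :
    ∃ O : Set (LocalModel 𝔽 c m × LocalModel 𝔽 c m), IsOpen O ∧ (β y, β y) ∈ O ∧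
      ContDiffOn ℝ ∞ (relFun J ρ ψ β) O ∧ ContDiffOn ℝ ∞ (relTotal J ρ β) O ∧
      ∀ p ∈ O, relTotal J ρ β p ≠ 0 ∧ p.1 ∈ β.target ∧
        ((0, p.2.2) : LocalModel 𝔽 c m) ∈ β.target ∧ (∀ i ∈ J, p ∈ relDomain (ψ i) β) ∧
        β.symm (0, p.2.2) ∈ V := by
  have hβ : ((0, (β y).2) : LocalModel 𝔽 c m) = β y := (h.apply_eq hs hy).symm
  let D : Set (LocalModel 𝔽 c m × LocalModel 𝔽 c m) :=
    {p | p.1 ∈ β.target ∧ ((0, p.2.2) : LocalModel 𝔽 c m) ∈ β.target}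
  let O₁ := D ∩ ⋂ i ∈ J, relDomain (ψ i) β
  have hO₁ : IsOpen O₁ := (isOpen_weightDomain β).inter
    (isOpen_biInter_finset fun i _ => isOpen_relDomain (ψ i) β)
  have hwt : ∀ i, ContDiffOn ℝ ∞ (relWeight ρ β i) O₁ := fun i =>
    (h.contDiffOn_relWeight (hρ i)).mono inter_subset_left
  have hT : ContDiffOn ℝ ∞ (relTotal J ρ β) O₁ := ContDiffOn.sum fun i _ => hwt i
  have hR : ContDiffOn ℝ ∞ (relFun J ρ ψ β) O₁ := ContDiffOn.sum fun i hi =>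
    (hwt i).smul ((h.contDiffOn_relTerm (hψ i hi)).mono fun p hp => mem_iInter₂.1 hp.2 i hi)
  have hb : ContinuousOn (fun p : LocalModel 𝔽 c m × LocalModel 𝔽 c m => β.symm (0, p.2.2)) O₁ :=
    β.symm.continuousOn.comp contDiff_zero_snd.continuous.continuousOn fun p hp => hp.1.2
  have hmem : (β y, β y) ∈ O₁ := by
    refine ⟨⟨β.map_source hs, ?_⟩, mem_iInter₂.2 fun i hi => ⟨?_, ?_⟩⟩
    · change ((0, (β y).2) : LocalModel 𝔽 c m) ∈ _
      rw [hβ]; exact β.map_source hs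
    · simp [hs, hs' i hi]
    · change ((0, (β y).2) : LocalModel 𝔽 c m) ∈ _
      rw [hβ]; simp [hs, hs' i hi]
  refine ⟨(O₁ ∩ relTotal J ρ β ⁻¹' {0}ᶜ) ∩ (O₁ ∩ (fun p => β.symm (0, p.2.2)) ⁻¹' V),
    (hT.continuousOn.isOpen_inter_preimage hO₁ isOpen_compl_singleton).inter
      (hb.isOpen_inter_preimage hO₁ hV), ⟨⟨hmem, ?_⟩, hmem, ?_⟩,
    hR.mono fun p hp => hp.1.1, hT.mono fun p hp => hp.1.1,
    fun p hp => ⟨hp.1.2, hp.1.1.1.1, hp.1.1.1.2, mem_iInter₂.1 hp.1.1.2, hp.2.2⟩⟩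
  · obtain ⟨i, hi, hi0⟩ := hw
    have : 0 < relTotal J ρ β (β y, β y) := by
      refine Finset.sum_pos' (fun j _ => ?_) ⟨i, hi, ?_⟩
      · simp only [relWeight, hβ]
        exact mul_self_nonneg _
      · simp only [relWeight, hβ, β.left_inv hs]
        exact mul_self_pos.2 hi0
    exact this.ne'
  · simpa [hβ, hs] using hyV

/-- The coordinates of the normal vector related to a point are `𝔽`-linear in the normal
coordinates of the point, up to a smooth factor. -/
theorem exists_linear_factor (h : IsChartFor (n := n) Y β)
    (hψ : ∀ i ∈ J, IsChartFor (n := n) Y (ψ i)) (hs : y ∈ β.source)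
    (hy : y ∈ Y)
    (hρ : ∀ i, ContMDiff 𝓘(ℝ, EuclideanSpace ℝ (Fin n)) 𝓘(ℝ, ℝ) ∞ (ρ i))
    {O : Set (LocalModel 𝔽 c m × LocalModel 𝔽 c m)}
    (hT : ContDiffOn ℝ ∞ (relTotal J ρ β) O)
    (hO : ∀ p ∈ O, relTotal J ρ β p ≠ 0 ∧ p.1 ∈ β.target ∧
        ((0, p.2.2) : LocalModel 𝔽 c m) ∈ β.target ∧ ∀ i ∈ J, p ∈ relDomain (ψ i) β)
    (hc : ∀ i ∈ J, CompatAt (ψ i) β y) (hc' : ∀ i ∈ J, CompatAt β (ψ i) y)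
    {e : LocalModel 𝔽 c m → LocalModel 𝔽 c m} {U : Set (LocalModel 𝔽 c m)}
    (hU : U ∈ 𝓝 (β y)) (hey : e (β y) = β y) (he : ContDiffOn ℝ ∞ e U)
    (heO : ∀ a ∈ U, (a, e a) ∈ O ∧ relFun J ρ ψ β (a, e a) = 0) :
    ∃ G : LocalModel 𝔽 c m → (Fin c → 𝔽) →L[𝔽] (Fin c → 𝔽), ∃ V ∈ 𝓝 (β y),
      ContDiffOn ℝ ∞ G V ∧ ∀ a ∈ V, (e a).1 = G a a.1 := by
  classical
  have hβ : ((0, (β y).2) : LocalModel 𝔽 c m) = β y := (h.apply_eq hs hy).symm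
  have hG : ∀ i, ∃ G : LocalModel 𝔽 c m → (Fin c → 𝔽) →L[𝔽] (Fin c → 𝔽),
      ∃ V : Set (LocalModel 𝔽 c m), i ∈ J → V ∈ 𝓝 (β y) ∧ ContDiffOn ℝ ∞ G V ∧
        ∀ a ∈ V, (ψ i (β.symm a)).1 = G a a.1 := by
    intro i
    by_cases hi : i ∈ J
    · obtain ⟨G, V, h1⟩ := hc i hi
      exact ⟨G, V, fun _ => h1⟩
    · exact ⟨0, ∅, fun h => absurd h hi⟩
  have hH : ∀ i, ∃ H : LocalModel 𝔽 c m → (Fin c → 𝔽) →L[𝔽] (Fin c → 𝔽),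
      ∃ V : Set (LocalModel 𝔽 c m), i ∈ J → IsOpen V ∧ ψ i y ∈ V ∧ ContDiffOn ℝ ∞ H V ∧
        ∀ a ∈ V, (β ((ψ i).symm a)).1 = H a a.1 := by
    intro i
    by_cases hi : i ∈ J
    · obtain ⟨H, V, hV, h1, h2⟩ := hc' i hi
      obtain ⟨V', hV', ho, hm⟩ := mem_nhds_iff.1 hV
      exact ⟨H, V', fun _ => ⟨ho, hm, h1.mono hV', fun a ha => h2 a (hV' ha)⟩⟩
    · exact ⟨0, ∅, fun h => absurd h hi⟩
  choose G V hGV using hG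
  choose H V' hHV using hH
  -- `g i a` is the foot point of the vector related to `a`, seen in `ψ i`; the `H i` are evaluated
  -- there and the `G i` at `a` itself.
  let g : ι → LocalModel 𝔽 c m → LocalModel 𝔽 c m := fun i a => ψ i (β.symm (0, (e a).2))
  have hg : ∀ i ∈ J, ContDiffOn ℝ ∞ (g i) U := by
    intro i hi
    refine (h.contDiffOn_trans (hψ i hi)).comp (f := fun a => ((0, (e a).2) : LocalModel 𝔽 c m))
      (contDiffOn_const.prodMk he.snd) fun a ha => ?_
    exact ((hO _ (heO a ha).1).2.2.2 i hi).2
  have hgy : ∀ i, g i (β y) = ψ i y := fun i => by simp [g, hey, hβ, hs]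
  let W : Set (LocalModel 𝔽 c m) := {a | a ∈ U ∧ ∀ i ∈ J, a ∈ V i ∧ g i a ∈ V' i}
  have hW : W ∈ 𝓝 (β y) := by
    refine Filter.inter_mem hU ((Finset.eventually_all J).2 fun i hi => ?_)
    refine Filter.inter_mem (hGV i hi).1 ?_
    have h1 : ContinuousAt (g i) (β y) := (hg i hi).continuousOn.continuousAt hU
    exact h1 (by rw [hgy]; exact (hHV i hi).1.mem_nhds (hHV i hi).2.1)
  have hpair : ContDiffOn ℝ ∞ (fun a => (a, e a)) W :=
    contDiff_id.contDiffOn.prodMk (he.mono fun a ha => ha.1)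
  refine ⟨fun a => (relTotal J ρ β (a, e a))⁻¹ • ∑ i ∈ J, relWeight ρ β i (a, e a) •
    (H i (g i a)).comp (G i a), W, hW, ?_, ?_⟩
  · refine ContDiffOn.smul ((hT.comp hpair fun a ha => (heO a ha.1).1).inv fun a ha =>
      (hO _ (heO a ha.1).1).1) (ContDiffOn.sum fun i hi => ContDiffOn.fun_smul ?_ ?_)
    · exact (h.contDiffOn_relWeight (hρ i)).comp hpair fun a ha =>
        ⟨(hO _ (heO a ha.1).1).2.1, (hO _ (heO a ha.1).1).2.2.1⟩
    · exact contDiff_clm_comp ((hHV i hi).2.2.1.comp ((hg i hi).mono fun a ha => ha.1)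
        fun a ha => (ha.2 i hi).2) ((hGV i hi).2.1.mono fun a ha => (ha.2 i hi).1)
  · intro a ha
    obtain ⟨haO, ha0⟩ := heO a ha.1
    obtain ⟨hw, ht, ht0, hd⟩ := hO _ haO
    have h1 := relFun_fst (J := J) (ρ := ρ) (ψ := ψ) (β := β) (a, e a)
    rw [ha0, Prod.fst_zero, eq_comm, sub_eq_zero] at h1
    have h2 : (e a).1 = (relTotal J ρ β (a, e a))⁻¹ •
        (relFun J ρ ψ β (a, (0, (e a).2))).1 := by
      rw [h1, smul_smul, inv_mul_cancel₀ hw, one_smul]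
    rw [h2, _root_.smul_apply, _root_.sum_apply]
    congr 1
    simp only [relFun, Prod.fst_sum, Prod.smul_fst]
    refine Finset.sum_congr rfl fun i hi => ?_
    rw [_root_.smul_apply]
    congr 1
    have hd2 := (hd i hi).2
    simp only [OpenPartialHomeomorph.trans_source, OpenPartialHomeomorph.symm_source,
      mem_inter_iff, mem_preimage] at hd2
    have hz : (g i a).1 = 0 := ((hψ i hi).slice _ hd2.2).1 (h.symm_mem hd2.1)
    have hV' := (hHV i hi).1.mem_nhds (ha.2 i hi).2
    have hdiff : HasFDerivAt (β ∘ (ψ i).symm) (transDeriv (ψ i) β (e a).2) (g i a) :=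
      ((((hψ i hi).contDiffOn_trans h).contDiffAt (((ψ i).symm ≫ₕ β).open_source.mem_nhds
        (by simp [hd2.1, hd2.2]))).differentiableAt (by simp)).hasFDerivAt
    -- Since the foot point is in `Y`, the differential acts on normal coordinates through the
    -- `𝔽`-linear `H i`, although `transDeriv` itself is only real linear.
    have key := fst_fderiv_of_fst_eq hz ((hHV i hi).2.2.1.contDiffAt hV') hdiff
      (Filter.eventually_of_mem hV' (hHV i hi).2.2.2) ((ψ i (β.symm a)).1, 0)
    simp only [relTerm, sub_zero]
    rw [key, (hGV i hi).2.2 a (ha.2 i hi).1]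
    rfl

end LocalSolution

/-! ### Local diffeomorphisms solving the relation. -/

namespace ClosedSubmanifold

variable {𝔽 : Type*} [RCLike 𝔽] {c m n : ℕ} {X : Type*} [TopologicalSpace X]
  [ChartedSpace (EuclideanSpace ℝ (Fin n)) X] {Y : ClosedSubmanifold 𝔽 c m n X}
  {ι : Type*} {J : Finset ι} {ρ : ι → X → ℝ}
  {ψ : ι → OpenPartialHomeomorph X (LocalModel 𝔽 c m)}
  {β : OpenPartialHomeomorph X (LocalModel 𝔽 c m)} {y : X}

theorem normalHomeo_zeroVec (h : IsChartFor (n := n) Y.carrier β) (p : Y.NormalBundle)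
    (hs : y ∈ β.source) (hy : y ∈ Y.carrier) : normalHomeo β h p (Y.zeroVec y hy) = β y := by
  have h1 := h.normalCoord_normalClass hs hy 0
  rw [map_zero, map_zero] at h1
  rw [h.apply_eq hs hy]
  exact Prod.ext h1 rfl

/-- Near a point of `Y`, the relation `IsRelated` is the graph of a diffeomorphism from an open
subset of `X` to an open subset of the normal bundle. -/
theorem exists_local_diffeo (h : IsChartFor (n := n) Y.carrier β) (p : Y.NormalBundle)
    (hψ : ∀ i ∈ J, IsChartFor (n := n) Y.carrier (ψ i)) (hs : y ∈ β.source)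
    (hs' : ∀ i ∈ J, y ∈ (ψ i).source) (hy : y ∈ Y.carrier)
    (hρ : ∀ i, ContMDiff 𝓘(ℝ, EuclideanSpace ℝ (Fin n)) 𝓘(ℝ, ℝ) ∞ (ρ i))
    (hw : ∃ i ∈ J, ρ i y ≠ 0) (hJ : ∀ᶠ x in 𝓝 y, ∀ i ∉ J, ρ i x = 0)
    (hc : ∀ i ∈ J, CompatAt (ψ i) β y) (hc' : ∀ i ∈ J, CompatAt β (ψ i) y) :
    ∃ e : OpenPartialHomeomorph X Y.NormalBundle, y ∈ e.source ∧ e y = Y.zeroVec y hy ∧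
      ContMDiffOn 𝓘(ℝ, EuclideanSpace ℝ (Fin n)) 𝓘(ℝ, LocalModel 𝔽 c m) ∞ e e.source ∧
      ContMDiffOn 𝓘(ℝ, LocalModel 𝔽 c m) 𝓘(ℝ, EuclideanSpace ℝ (Fin n)) ∞ e.symm e.target ∧
      (∀ x ∈ e.source, IsRelated ρ ψ x (e x)) ∧
      (∀ᶠ p in 𝓝 (y, y), ∀ q : Y.NormalBundle, q.base = p.2 → IsRelated ρ ψ p.1 q →
        p.1 ∈ e.source ∧ e p.1 = q) ∧
      (∃ L : LocalModel 𝔽 c m ≃L[ℝ] LocalModel 𝔽 c m, (∀ v, (L v).1 = v.1) ∧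
        HasFDerivAt (normalHomeo β h p ∘ e ∘ β.symm)
          (L : LocalModel 𝔽 c m →L[ℝ] LocalModel 𝔽 c m) (β y)) ∧
      CompatAt (e ≫ₕ normalHomeo β h p) β y := by
  have hβ : ((0, (β y).2) : LocalModel 𝔽 c m) = β y := (h.apply_eq hs hy).symm
  -- For foot points in `V` the sums over all charts reduce to `J`, and every chart in `J` is
  -- defined there.
  obtain ⟨V, hVJ, hV, hyV⟩ := eventually_nhds_iff.1 (hJ.and
    ((Finset.eventually_all J).2 fun i hi => (ψ i).open_source.mem_nhds (hs' i hi)))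
  obtain ⟨O, hO, hyO, hK, hT, hOp⟩ := exists_relFun_domain h hψ hs hs' hy hρ hw hV hyV
  obtain ⟨L, hL, D, hD, hDL⟩ := h.hasFDerivAt_relFun hψ hs hs' hy hρ (hOp _ hyO).1
  have hK0 : relFun J ρ ψ β (β y, β y) = 0 := by
    refine Finset.sum_eq_zero fun i hi => ?_
    rw [h.relTerm_self (hψ i hi) hs (hs' i hi) hy, smul_zero]
  obtain ⟨e₀, hye, hey, he, hes, hed, heO, hloc⟩ :=
    exists_localDiffeo_of_relation hO hyO hK hK0 hD (hOp _ hyO).1 hDL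
  let ν := normalHomeo β h p
  let e : OpenPartialHomeomorph X Y.NormalBundle := (β ≫ₕ e₀) ≫ₕ ν.symm
  have htarget : ∀ a ∈ e₀.source, e₀ a ∈ ν.target := fun a ha => (hOp _ (heO a ha).1).2.2.1
  have hmem : ∀ x, x ∈ e.source ↔ x ∈ β.source ∧ β x ∈ e₀.source := by
    intro x
    simp only [e, OpenPartialHomeomorph.trans_source, OpenPartialHomeomorph.symm_source,
      mem_inter_iff, mem_preimage]
    exact ⟨fun hx => hx.1, fun hx => ⟨hx, htarget _ hx.2⟩⟩
  have hνe : ∀ x ∈ e.source, ν (e x) = e₀ (β x) := fun x hx =>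
    ν.right_inv (htarget _ ((hmem x).1 hx).2)
  have hbase : ∀ x ∈ e.source, (e x).base = β.symm (0, (e₀ (β x)).2) := fun x hx =>
    normalHomeo_symm_base h p (hOp _ (heO _ ((hmem x).1 hx).2).1).2.2.1
  have hνs : ∀ x ∈ e.source, (e x).base ∈ β.source := fun x hx => by
    rw [hbase x hx]
    exact β.map_target (hOp _ (heO _ ((hmem x).1 hx).2).1).2.2.1
  have hesource : ∀ a ∈ e₀.source, a ∈ β.target ∧ β.symm a ∈ e.source := by
    intro a ha
    have h1 := (hOp _ (heO _ ha).1).2.1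
    exact ⟨h1, (hmem _).2 ⟨β.map_target h1, by rwa [β.right_inv h1]⟩⟩
  have hνeβ : ∀ a ∈ e₀.source, ν (e (β.symm a)) = e₀ a := by
    intro a ha
    obtain ⟨h1, h2⟩ := hesource a ha
    rw [hνe _ h2, β.right_inv h1]
  refine ⟨e, (hmem y).2 ⟨hs, hye⟩, ?_, ?_, ?_, ?_, ?_, ⟨L, hL, ?_⟩, ?_⟩
  · change ν.symm (e₀ (β y)) = _
    rw [hey, ← normalHomeo_zeroVec h p hs hy]
    exact ν.left_inv hs
  · refine (contMDiffOn_normalHomeo_symm h p).comp (t := ν.target)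
      (he.contMDiffOn.comp (h.smooth.mono fun x hx => ((hmem x).1 hx).1) fun x hx =>
        ((hmem x).1 hx).2) fun x hx => htarget _ ((hmem x).1 hx).2
  · have ht : ∀ q ∈ e.target, q ∈ ν.source ∧ ν q ∈ e₀.target ∧ e₀.symm (ν q) ∈ β.target := by
      intro q hq
      simpa [e, and_assoc] using hq
    exact (h.smooth_symm.comp (hes.contMDiffOn.comp
      ((contMDiffOn_normalHomeo h p).mono fun q hq => (ht q hq).1) fun q hq => (ht q hq).2.1)
      fun q hq => (ht q hq).2.2)
  · intro x hx
    have h1 := heO _ ((hmem x).1 hx).2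
    have hxV : (e x).base ∈ V := by rw [hbase x hx]; exact (hOp _ h1.1).2.2.2.2
    rw [isRelated_iff h p hψ ((hmem x).1 hx).1 (hνs x hx) (hVJ _ hxV).1 (hVJ _ hxV).2]
    change relFun J ρ ψ β (β x, ν (e x)) = 0
    rw [hνe x hx]
    exact h1.2
  -- Uniqueness must hold for `x` and the foot point near `y`, with no smallness assumed on the
  -- vector. By `relFun_fst` the vector's coordinates are those in `Γ`, which is continuous at `(y,
  -- y)` with zero normal vector there, so related vectors are automatically small.
  · let Γ₀ : X × X → LocalModel 𝔽 c m × LocalModel 𝔽 c m := fun p => (β p.1, (0, (β p.2).2))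
    let Γ : X × X → LocalModel 𝔽 c m × LocalModel 𝔽 c m := fun p =>
      (β p.1, ((relTotal J ρ β (Γ₀ p))⁻¹ • (relFun J ρ ψ β (Γ₀ p)).1, (β p.2).2))
    have hβ1 : ContinuousAt (fun p : X × X => β p.1) (y, y) :=
      (β.continuousAt hs).comp (f := Prod.fst) (x := (y, y)) continuousAt_fst
    have hβ2 : ContinuousAt (fun p : X × X => (β p.2).2) (y, y) :=
      continuousAt_snd.comp ((β.continuousAt hs).comp (f := Prod.snd) (x := (y, y))
        continuousAt_snd)
    have hΓ₀y : Γ₀ (y, y) = (β y, β y) := by simp [Γ₀, hβ]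
    have hΓ₀ : ContinuousAt Γ₀ (y, y) := hβ1.prodMk (continuousAt_const.prodMk hβ2)
    have hOn : O ∈ 𝓝 (Γ₀ (y, y)) := hΓ₀y ▸ hO.mem_nhds hyO
    have hT1 := (hT.continuousOn.continuousAt hOn).comp hΓ₀
    have hK1 := (hK.continuousOn.continuousAt hOn).comp hΓ₀
    have hΓ : ContinuousAt Γ (y, y) := hβ1.prodMk (((hT1.inv₀ (by
      simp only [Function.comp_apply, hΓ₀y]; exact (hOp _ hyO).1)).smul
        (continuousAt_fst.comp hK1)).prodMk hβ2)
    have hΓy : Γ (y, y) = (β y, β y) := by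
      simp only [Γ, hΓ₀y, hK0, Prod.fst_zero, smul_zero, hβ]
    filter_upwards [hΓ.eventually (hΓy.symm ▸ hloc), hΓ₀ hOn,
      continuousAt_fst.preimage_mem_nhds (β.open_source.mem_nhds hs),
      continuousAt_snd.preimage_mem_nhds (Filter.inter_mem (hV.mem_nhds hyV)
        (β.open_source.mem_nhds hs))] with r hr hrO hr1 hr2 q hq hrel
    obtain ⟨x, y'⟩ := r
    simp only at hq hr1 hr2 hrel
    obtain rfl := hq
    have hV' := hVJ _ hr2.1
    rw [isRelated_iff h p hψ hr1 hr2.2 hV'.1 hV'.2] at hrel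
    have hqν : q ∈ ν.source := hr2.2
    have h1 := relFun_fst (J := J) (ρ := ρ) (ψ := ψ) (β := β) (β x, ν q)
    have hrel' : relFun J ρ ψ β (β x, ν q) = 0 := hrel
    rw [hrel', Prod.fst_zero, eq_comm, sub_eq_zero] at h1
    have h2 : Γ (x, q.base) = (β x, ν q) := by
      refine Prod.ext rfl (Prod.ext ?_ rfl)
      change (relTotal J ρ β (Γ₀ (x, q.base)))⁻¹ •
        (relFun J ρ ψ β (β x, (0, (ν q).2))).1 = (ν q).1
      rw [h1, smul_smul]
      have h3 : relTotal J ρ β (β x, ν q) = relTotal J ρ β (Γ₀ (x, q.base)) := rfl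
      rw [h3, inv_mul_cancel₀ (hOp _ hrO).1, one_smul]
    rw [h2] at hr
    obtain ⟨h4, h5⟩ := hr hrel'
    refine ⟨(hmem x).2 ⟨hr1, h4⟩, ?_⟩
    change ν.symm (e₀ (β x)) = q
    rw [h5, ν.left_inv hqν]
  · exact hed.congr_of_eventuallyEq
      (Filter.eventually_of_mem (e₀.open_source.mem_nhds hye) fun a ha => hνeβ a ha)
  · obtain ⟨G, V', hV', hG, hGe⟩ := exists_linear_factor h hψ hs hy hρ hT
      (fun p hp => ⟨(hOp p hp).1, (hOp p hp).2.1, (hOp p hp).2.2.1, (hOp p hp).2.2.2.1⟩) hc hc'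
      (e₀.open_source.mem_nhds hye) hey he heO
    refine ⟨G, V' ∩ e₀.source, Filter.inter_mem hV' (e₀.open_source.mem_nhds hye),
      hG.mono inter_subset_left, fun a ha => ?_⟩
    rw [← hGe a ha.1, ← hνeβ a ha.2]
    rfl

end ClosedSubmanifold

/-! ### Passing to charts and maps with the same germ. -/

section Germs

theorem eventuallyEq_symm_of_eventuallyEq {X N : Type*} [TopologicalSpace X] [TopologicalSpace N]
    {Θ e : OpenPartialHomeomorph X N} {x : X} (hx : x ∈ Θ.source) (hx' : x ∈ e.source)
    (h : Θ =ᶠ[𝓝 x] e) : Θ.symm =ᶠ[𝓝 (Θ x)] e.symm := by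
  have hc : Filter.Tendsto Θ.symm (𝓝 (Θ x)) (𝓝 x) := by
    have := Θ.symm.continuousAt (x := Θ x) (Θ.map_source hx)
    rwa [ContinuousAt, Θ.left_inv hx] at this
  filter_upwards [hc.eventually (h.and (e.open_source.mem_nhds hx')),
    Θ.open_target.mem_nhds (Θ.map_source hx)] with q hq hqt
  rw [Θ.right_inv hqt] at hq
  rw [← e.left_inv hq.2, ← hq.1]

variable {𝔽 : Type*} [RCLike 𝔽] {c m n : ℕ} {X : Type*} [TopologicalSpace X]
  [ChartedSpace (EuclideanSpace ℝ (Fin n)) X] {Y : Set X}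
  {φ φ₁ φ' : OpenPartialHomeomorph X (LocalModel 𝔽 c m)} {y : X}

theorem IsChartFor.congr_source (h : IsChartFor (n := n) Y φ) (e : φ₁ ≈ φ) :
    IsChartFor (n := n) Y φ₁ where
  smooth := by
    rw [e.1]
    exact h.smooth.congr fun x hx => e.2 (e.1.symm ▸ hx)
  smooth_symm := by
    have ht : φ₁.target = φ.target := (e.symm').1
    rw [ht]
    exact h.smooth_symm.congr fun x hx => e.symm'.2 (by change x ∈ φ₁.target; rwa [ht])
  slice x hx := by
    rw [e.2 hx]
    exact h.slice x (e.1 ▸ hx)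

theorem CompatAt.congr_left (h : CompatAt φ φ' y) (hy : y ∈ φ'.source)
    (e : φ₁ =ᶠ[𝓝 y] φ) : CompatAt φ₁ φ' y := by
  obtain ⟨G, V, hV, hG, hGe⟩ := h
  have hc : Filter.Tendsto φ'.symm (𝓝 (φ' y)) (𝓝 y) := by
    have := φ'.symm.continuousAt (x := φ' y) (φ'.map_source hy)
    rwa [ContinuousAt, φ'.left_inv hy] at this
  refine ⟨G, V ∩ {p | φ₁ (φ'.symm p) = φ (φ'.symm p)}, Filter.inter_mem hV (hc.eventually e),
    hG.mono inter_subset_left, fun p hp => ?_⟩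
  rw [← hGe p hp.1, show φ₁ (φ'.symm p) = φ (φ'.symm p) from hp.2]

end Germs

/-! ### Cut-out charts and their compatibility with the atlas. -/

namespace ClosedSubmanifold

variable {𝔽 : Type*} [RCLike 𝔽] {c m n : ℕ} {X : Type*} [TopologicalSpace X]
  [ChartedSpace (EuclideanSpace ℝ (Fin n)) X] {Y : ClosedSubmanifold 𝔽 c m n X}
  {A : Set (OpenPartialHomeomorph X (LocalModel 𝔽 c m))}
  {Φ : OpenPartialHomeomorph Y.NormalBundle (LocalModel 𝔽 c m)}
  {Θ : OpenPartialHomeomorph X Y.NormalBundle}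
  {β φ φ' : OpenPartialHomeomorph X (LocalModel 𝔽 c m)} {y : X}

theorem IsAtlas.compatAt (hA : Y.IsAtlas A) (hφ : φ ∈ A) (hφ' : φ' ∈ A) (hs : y ∈ φ.source)
    (hs' : y ∈ φ'.source) : CompatAt φ φ' y := by
  obtain ⟨h, h1, h2⟩ := hA.compatible φ hφ φ' hφ'
  refine ⟨h, _, ?_, h1, h2⟩
  exact φ'.image_mem_nhds hs' ((φ.open_source.inter φ'.open_source).mem_nhds ⟨hs, hs'⟩)

/-- Pairwise compatibility of charts follows from compatibility with an atlas near each point of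
the submanifold. -/
theorem IsAtlas.atlasEquiv (hA : Y.IsAtlas A)
    {B : Set (OpenPartialHomeomorph X (LocalModel 𝔽 c m))}
    (hB : ∀ φ ∈ B, IsChartFor (n := n) Y.carrier φ) (hcover : Y.carrier ⊆ ⋃ φ ∈ B, φ.source)
    (h : ∀ φ ∈ B, ∀ α ∈ A, ∀ y ∈ Y.carrier, y ∈ φ.source → y ∈ α.source → CompatAt φ α y) :
    Y.AtlasEquiv A B := by
  have hchart : ∀ φ ∈ A ∪ B, IsChartFor (n := n) Y.carrier φ := by
    rintro φ (hφ | hφ)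
    · exact hA.isChartFor φ hφ
    · exact hB φ hφ
  have hAB : ∀ φ ∈ A ∪ B, ∀ α ∈ A, ∀ y ∈ Y.carrier, y ∈ φ.source → y ∈ α.source →
      CompatAt φ α y := by
    rintro φ (hφ | hφ) α hα y hy hs hs'
    · exact hA.compatAt hφ hα hs hs'
    · exact h φ hφ α hα y hy hs hs'
  have hcompat : ∀ φ ∈ A ∪ B, ∀ φ' ∈ A ∪ B,
      ∃ h : LocalModel 𝔽 c m → (Fin c → 𝔽) →L[𝔽] (Fin c → 𝔽),
        ContDiffOn ℝ ∞ h (φ' '' (φ.source ∩ φ'.source)) ∧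
        ∀ p ∈ φ' '' (φ.source ∩ φ'.source), (φ (φ'.symm p)).1 = h p p.1 := by
    intro φ hφ φ' hφ'
    refine exists_contDiffOn_fst_eq (hchart φ hφ) (hchart φ' hφ') fun y hy hs hs' => ?_
    -- An atlas chart `α` through `y` mediates between `φ` and `φ'`.
    obtain ⟨α, hα, hsα⟩ := mem_iUnion₂.1 (hA.cover hy)
    exact (hAB φ hφ α hα y hy hs hsα).trans
      ((hAB φ' hφ' α hα y hy hs' hsα).symm (hchart φ' hφ') (hA.isChartFor α hα) hs' hsα hy)
      (hA.isChartFor α hα) (hchart φ' hφ') hsα hs'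
  exact ⟨hA, ⟨hB, hcover, fun φ hφ φ' hφ' => hcompat φ (Or.inr hφ) φ' (Or.inr hφ')⟩,
    ⟨hchart, fun y hy => by
      obtain ⟨α, hα, hsα⟩ := mem_iUnion₂.1 (hA.cover hy)
      exact mem_iUnion₂.2 ⟨α, Or.inl hα, hsα⟩, hcompat⟩⟩

theorem IsTrivialization.zeroVec_mem (hΦ : Y.IsTrivialization A Φ) {q : Y.NormalBundle}
    (hq : q ∈ Φ.source) : Y.zeroVec q.base q.base_mem ∈ Φ.source := by
  obtain ⟨U, -, hU⟩ := hΦ.source_eq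
  rw [hU] at hq ⊢
  exact hq

theorem IsTrivialization.fst_eq_zero_iff (hΦ : Y.IsTrivialization A Φ) (hA : Y.IsAtlas A)
    {q : Y.NormalBundle} (hq : q ∈ Φ.source) :
    (Φ q).1 = 0 ↔ q = Y.zeroVec q.base q.base_mem := by
  have h0 := hΦ.zeroVec_mem hq
  obtain ⟨y, hy, v⟩ := q
  obtain ⟨α, hα, hs⟩ := mem_iUnion₂.1 (hA.cover hy)
  obtain ⟨T, hT⟩ := hΦ.linear y hy h0 α hα hs
  have hc := hA.isChartFor α hα
  have hf0 : normalFrame n Y.carrier α y 0 = 0 := by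
    rw [normalFrame_eq, Prod.mk_zero_zero, map_zero, map_zero]
  constructor
  · intro h
    rw [← hc.normalFrame_coord hs hy v, hT, LinearEquiv.map_eq_zero_iff] at h
    have : v = 0 := by rw [← hc.normalFrame_coord hs hy v, h, hf0]
    rw [this]; rfl
  · intro h
    rw [h, zeroVec]
    dsimp only
    rw [← hf0, hT, map_zero]

/-- The slice property holds because `Φ` has zero normal part exactly on zero vectors; if `Θ x` is
the zero vector at `y'`, it equals `Θ y'`, and injectivity gives `x = y'`. -/
theorem isChartFor_trans (hA : Y.IsAtlas A) (hΦ : Y.IsTrivialization A Φ)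
    (hs : ContMDiffOn 𝓘(ℝ, EuclideanSpace ℝ (Fin n)) 𝓘(ℝ, LocalModel 𝔽 c m) ∞ Θ Θ.source)
    (hs' : ContMDiffOn 𝓘(ℝ, LocalModel 𝔽 c m) 𝓘(ℝ, EuclideanSpace ℝ (Fin n)) ∞ Θ.symm Θ.target)
    (hmem : ∀ y ∈ Y.carrier, y ∈ Θ.source) (h0 : ∀ y hy, Θ y = Y.zeroVec y hy) :
    IsChartFor (n := n) Y.carrier (Θ ≫ₕ Φ) where
  smooth := hΦ.smooth.comp (hs.mono fun x hx => hx.1) fun x hx => hx.2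
  smooth_symm := hs'.comp (hΦ.smooth_symm.mono fun x hx => hx.1) fun x hx => hx.2
  slice x hx := by
    have hx1 : x ∈ Θ.source := hx.1
    have hx2 : Θ x ∈ Φ.source := hx.2
    rw [OpenPartialHomeomorph.coe_trans, Function.comp_apply, hΦ.fst_eq_zero_iff hA hx2]
    constructor
    · intro hy
      rw [h0 x hy]; rfl
    · intro h
      rw [← h0 _ (Θ x).base_mem] at h
      rw [Θ.injOn hx1 (hmem _ (Θ x).base_mem) h]
      exact (Θ x).base_mem

/-- Two fiberwise linear charts of the normal bundle differ by an `𝔽`-linear operator that depends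
smoothly on the foot point, and composing it with the factor for `normalHomeo` gives the new factor.
-/
theorem IsTrivialization.compatAt (hΦ : Y.IsTrivialization A Φ) (hβA : β ∈ A)
    (h : IsChartFor (n := n) Y.carrier β) (p : Y.NormalBundle)
    (hs : ContMDiffOn 𝓘(ℝ, EuclideanSpace ℝ (Fin n)) 𝓘(ℝ, LocalModel 𝔽 c m) ∞ Θ Θ.source)
    (hy : y ∈ Y.carrier) (h0 : Θ y = Y.zeroVec y hy) (hyΘ : y ∈ Θ.source) (hyβ : y ∈ β.source)
    (hyΦ : Y.zeroVec y hy ∈ Φ.source) (hc : CompatAt (Θ ≫ₕ normalHomeo β h p) β y) :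
    CompatAt (Θ ≫ₕ Φ) β y := by
  classical
  obtain ⟨G, V, hV, hG, hGe⟩ := hc
  set ν := normalHomeo β h p with hν
  obtain ⟨U, hUo, hU⟩ := hΦ.source_eq
  let D : Set (Fin m → ℝ) := {t | ∃ ht : ((0, t) : LocalModel 𝔽 c m) ∈ β.target,
    β.symm (0, t) ∈ U}
  let S : Fin c → (Fin c → 𝔽) →L[ℝ] ((Fin c → 𝔽) →L[𝔽] (Fin c → 𝔽)) := fun j =>
    (ContinuousLinearMap.smulRightL 𝔽 (Fin c → 𝔽) (Fin c → 𝔽)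
      (ContinuousLinearMap.proj j)).restrictScalars ℝ
  -- The matrix of the fiber map is assembled from the images of the standard basis vectors, which
  -- makes smoothness in `t` visible.
  let T : (Fin m → ℝ) → (Fin c → 𝔽) →L[𝔽] (Fin c → 𝔽) := fun t =>
    ∑ j, S j (Φ (ν.symm (Pi.single j 1, t))).1
  have hνΦ : ∀ t ∈ D, ∀ r, ν.symm ((r, t) : LocalModel 𝔽 c m) ∈ Φ.source := by
    rintro t ⟨ht, htU⟩ r
    rw [hU]
    change (ν.symm ((r, t) : LocalModel 𝔽 c m)).base ∈ U
    rw [normalHomeo_symm_base h p (z := (r, t)) ht]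
    exact htU
  have hT : ContDiffOn ℝ ∞ T D := by
    refine ContDiffOn.sum fun j _ => (S j).contDiff.comp_contDiffOn (ContDiffOn.fst ?_)
    refine ContMDiffOn.contDiffOn (hΦ.smooth.comp ((contMDiffOn_normalHomeo_symm h p).comp
      (f := fun t : Fin m → ℝ => ((Pi.single j 1, t) : LocalModel 𝔽 c m))
      (by fun_prop : ContDiff ℝ ∞ fun t : Fin m → ℝ =>
        ((Pi.single j 1, t) : LocalModel 𝔽 c m)).contMDiff.contMDiffOn
      fun t ht => ht.1) fun t ht => hνΦ t ht _)
  have hTe : ∀ t ∈ D, ∀ r, (Φ (ν.symm ((r, t) : LocalModel 𝔽 c m))).1 = T t r := by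
    rintro t ⟨ht, htU⟩ r
    obtain ⟨L, hL⟩ := hΦ.linear (β.symm (0, t)) (h.symm_mem ht) (by rw [hU]; exact htU) β hβA
      (β.map_target ht)
    have h1 : ∀ r, (Φ (ν.symm ((r, t) : LocalModel 𝔽 c m))).1 = L r := by
      intro r
      rw [hν, normalHomeo_symm_apply h p (z := (r, t)) ht, hL]
    have h2 : T t r = ∑ j, r j • L (Pi.single j 1) := by
      simp only [T, _root_.sum_apply, h1]
      rfl
    rw [h1, h2]
    conv_lhs => rw [pi_eq_sum_univ' r, map_sum]
    refine Finset.sum_congr rfl fun j _ => ?_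
    rw [map_smul]
  let W : Set (LocalModel 𝔽 c m) := ((β.symm ≫ₕ Θ) ≫ₕ ν).source ∩ ((β.symm ≫ₕ Θ) ≫ₕ Φ).source
  have hW : ∀ a ∈ W, a ∈ β.target ∧ β.symm a ∈ Θ.source ∧ Θ (β.symm a) ∈ ν.source ∧
      Θ (β.symm a) ∈ Φ.source := by
    intro a ha
    simp [W] at ha
    tauto
  have hνsm : ContDiffOn ℝ ∞ (fun a => ν (Θ (β.symm a))) W :=
    ((contMDiffOn_normalHomeo h p).comp (hs.comp (h.smooth_symm.mono fun a ha => (hW a ha).1)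
      fun a ha => (hW a ha).2.1) fun a ha => (hW a ha).2.2.1).contDiffOn
  have hWD : ∀ a ∈ W, (ν (Θ (β.symm a))).2 ∈ D := by
    intro a ha
    obtain ⟨-, -, h3, h4⟩ := hW a ha
    have h5 : ((0, (ν (Θ (β.symm a))).2) : LocalModel 𝔽 c m) ∈ β.target := ν.map_source h3
    refine ⟨h5, ?_⟩
    have h6 := normalHomeo_symm_base h p (z := ν (Θ (β.symm a))) h5
    rw [← h6, ← hν, ν.left_inv h3]
    rwa [hU] at h4
  refine ⟨fun a => (T (ν (Θ (β.symm a))).2).comp (G a), V ∩ W, Filter.inter_mem hV ?_, ?_, ?_⟩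
  · have hν0 : Y.zeroVec y hy ∈ ν.source := hyβ
    have hyW : β y ∈ W := by simp [W, hyβ, hyΘ, h0, hyΦ, hν0]
    exact (((β.symm ≫ₕ Θ) ≫ₕ ν).open_source.inter
      ((β.symm ≫ₕ Θ) ≫ₕ Φ).open_source).mem_nhds hyW
  · exact contDiff_clm_comp (hT.comp (hνsm.snd.mono inter_subset_right) fun a ha => hWD a ha.2)
      (hG.mono inter_subset_left)
  · rintro a ⟨haV, haW⟩
    have h1 := hTe _ (hWD a haW) (ν (Θ (β.symm a))).1
    rw [Prod.mk.eta, ν.left_inv (hW a haW).2.2.1] at h1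
    have h2 : (ν (Θ (β.symm a))).1 = G a a.1 := hGe a haV
    change (Φ (Θ (β.symm a))).1 = _
    rw [h1, h2]
    rfl

/-! ### The normal derivative along the zero section, and the global tubular map. -/

theorem normalCoord_smul (h : IsChartFor (n := n) Y.carrier β) (hs : y ∈ β.source)
    (hy : y ∈ Y.carrier) (t : ℝ) (v : NormalSpace n Y.carrier y) :
    normalCoord n Y.carrier β y (t • v) = t • normalCoord n Y.carrier β y v := by
  obtain ⟨u, rfl⟩ := normalClass_surjective v
  rw [← map_smul, h.normalCoord_normalClass hs hy, h.normalCoord_normalClass hs hy, map_smul,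
    Prod.smul_fst]

/-- The curve `t ↦ t v` is the line `ℓ` with velocity `(r, 0)` in the normal chart. If `u` is the
velocity of its image in `X`, the chain rule gives `L (dβ u) = (r, 0)`, and since `L` fixes first
components, `u` has the normal coordinates `r` of `v`. -/
theorem deriv_vertical_of_hasFDerivAt (h : IsChartFor (n := n) Y.carrier β) (p : Y.NormalBundle)
    {Ψ : OpenPartialHomeomorph Y.NormalBundle X}
    (hsm : ContMDiffOn 𝓘(ℝ, LocalModel 𝔽 c m) 𝓘(ℝ, EuclideanSpace ℝ (Fin n)) ∞ Ψ Ψ.source)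
    (hy : y ∈ Y.carrier) (hs : y ∈ β.source) (hmem : Y.zeroVec y hy ∈ Ψ.source)
    (h0 : Ψ (Y.zeroVec y hy) = y) {L : LocalModel 𝔽 c m ≃L[ℝ] LocalModel 𝔽 c m}
    (hL : ∀ v, (L v).1 = v.1)
    (hd : HasFDerivAt (normalHomeo β h p ∘ Ψ.symm ∘ β.symm)
      (L : LocalModel 𝔽 c m →L[ℝ] LocalModel 𝔽 c m) (β y)) (v : NormalSpace n Y.carrier y) :
    normalClass n Y.carrier y (mfderiv 𝓘(ℝ, ℝ) 𝓘(ℝ, EuclideanSpace ℝ (Fin n))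
      (fun t : ℝ => Ψ ⟨y, hy, t • v⟩) 0 (1 : ℝ)) = v := by
  set ν := normalHomeo β h p with hν
  set r := normalCoord n Y.carrier β y v with hr
  let ℓ : ℝ → LocalModel 𝔽 c m := fun t => (t • r, (β y).2)
  have hβ : ((0, (β y).2) : LocalModel 𝔽 c m) = β y := (h.apply_eq hs hy).symm
  have hℓ : ContDiff ℝ ∞ ℓ := by fun_prop
  have hℓd : HasDerivAt ℓ ((r, 0) : LocalModel 𝔽 c m) 0 := by
    simpa using ((hasDerivAt_id (0 : ℝ)).smul_const r).prodMk (hasDerivAt_const (0 : ℝ) (β y).2)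
  let q : ℝ → Y.NormalBundle := fun t => ⟨y, hy, t • v⟩
  have hνq : ∀ t, ν (q t) = ℓ t := fun t =>
    Prod.ext (normalCoord_smul h hs hy t v) rfl
  have hqs : ∀ t, q t ∈ ν.source := fun t => hs
  have hq : ∀ t, q t = ν.symm (ℓ t) := fun t => by rw [← hνq, ν.left_inv (hqs t)]
  have hq0 : q 0 = Y.zeroVec y hy := by simp [q, zeroVec]
  have hℓt : ∀ t, ℓ t ∈ ν.target := fun t => hνq t ▸ ν.map_source (hqs t)
  have hqsm : ContMDiff 𝓘(ℝ, ℝ) 𝓘(ℝ, LocalModel 𝔽 c m) ∞ q := by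
    rw [show q = ν.symm ∘ ℓ from funext hq, ← contMDiffOn_univ]
    exact (contMDiffOn_normalHomeo_symm h p).comp hℓ.contMDiff.contMDiffOn fun t _ => hℓt t
  let γ : ℝ → X := fun t => Ψ (q t)
  have hγ0 : γ 0 = y := by simp only [γ, hq0, h0]
  have hγd : MDifferentiableAt 𝓘(ℝ, ℝ) 𝓘(ℝ, EuclideanSpace ℝ (Fin n)) γ 0 :=
    ((hsm.contMDiffAt (Ψ.open_source.mem_nhds (hq0.symm ▸ hmem))).comp (0 : ℝ)
      hqsm.contMDiffAt).mdifferentiableAt (by simp)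
  let u : EuclideanSpace ℝ (Fin n) :=
    mfderiv 𝓘(ℝ, ℝ) 𝓘(ℝ, EuclideanSpace ℝ (Fin n)) γ 0 (1 : ℝ)
  change normalClass n Y.carrier y u = v
  have hβd : MDifferentiableAt 𝓘(ℝ, EuclideanSpace ℝ (Fin n)) 𝓘(ℝ, LocalModel 𝔽 c m) β (γ 0) := by
    rw [hγ0]; exact h.mdifferentiable.mdifferentiableAt hs
  have hβγ : HasDerivAt (β ∘ γ) (chartDiff n β y u) 0 := by
    let g : ℝ →L[ℝ] EuclideanSpace ℝ (Fin n) :=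
      mfderiv 𝓘(ℝ, ℝ) 𝓘(ℝ, EuclideanSpace ℝ (Fin n)) γ 0
    have h1 : HasFDerivAt (β ∘ γ) ((chartDiff n β (γ 0)).comp g) 0 :=
      (HasMFDerivAt.comp (0 : ℝ) hβd.hasMFDerivAt hγd.hasMFDerivAt).hasFDerivAt
    refine h1.hasDerivAt.congr_deriv ?_
    change chartDiff n β (γ 0) u = _
    rw [hγ0]
  have hcomp : HasDerivAt ((ν ∘ Ψ.symm ∘ β.symm) ∘ (β ∘ γ)) (L (chartDiff n β y u)) 0 :=
    HasFDerivAt.comp_hasDerivAt (0 : ℝ) (by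
      simpa only [Function.comp_apply, hγ0] using hd) hβγ
  have hev : (ν ∘ Ψ.symm ∘ β.symm) ∘ (β ∘ γ) =ᶠ[𝓝 0] ℓ := by
    filter_upwards [hγd.continuousAt.preimage_mem_nhds (β.open_source.mem_nhds
      (hγ0.symm ▸ hs)), hqsm.continuous.continuousAt.preimage_mem_nhds
      (Ψ.open_source.mem_nhds (hq0.symm ▸ hmem))] with t ht1 ht2
    have h1 : β.symm (β (γ t)) = γ t := β.left_inv ht1
    have h2 : Ψ.symm (γ t) = q t := Ψ.left_inv ht2
    simp only [Function.comp_apply, h1, h2, hνq]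
  have hLu := hcomp.unique (hℓd.congr_of_eventuallyEq hev)
  have h1 : (chartDiff n β y u).1 = r := by rw [← hL, hLu]
  rw [← h.normalFrame_coord hs hy v, ← h.normalFrame_coord hs hy (normalClass n Y.carrier y u),
    h.normalCoord_normalClass hs hy, h1]

/-- There is a diffeomorphism `Θ` from a neighborhood of `Y` in `X` onto a neighborhood of the zero
section in the normal bundle whose normal component is `𝔽`-linear in the normal coordinates of each
chart of the atlas `A`, up to a smooth factor. -/
theorem exists_tubular_map [T2Space X] [SecondCountableTopology X]
    [IsManifold 𝓘(ℝ, EuclideanSpace ℝ (Fin n)) ∞ X] (hY : Y.carrier.Nonempty)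
    (hA : Y.IsAtlas A) :
    ∃ Θ : OpenPartialHomeomorph X Y.NormalBundle,
      ContMDiffOn 𝓘(ℝ, EuclideanSpace ℝ (Fin n)) 𝓘(ℝ, LocalModel 𝔽 c m) ∞ Θ Θ.source ∧
      ContMDiffOn 𝓘(ℝ, LocalModel 𝔽 c m) 𝓘(ℝ, EuclideanSpace ℝ (Fin n)) ∞ Θ.symm Θ.target ∧
      ∀ (y : X) (hy : y ∈ Y.carrier), y ∈ Θ.source ∧ Θ y = Y.zeroVec y hy ∧
        ∃ β ∈ A, y ∈ β.source ∧ ∃ h : IsChartFor (n := n) Y.carrier β, ∃ p : Y.NormalBundle,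
          (∃ L : LocalModel 𝔽 c m ≃L[ℝ] LocalModel 𝔽 c m, (∀ v, (L v).1 = v.1) ∧
            HasFDerivAt (normalHomeo β h p ∘ Θ ∘ β.symm)
              (L : LocalModel 𝔽 c m →L[ℝ] LocalModel 𝔽 c m) (β y)) ∧
          CompatAt (Θ ≫ₕ normalHomeo β h p) β y := by
  have : LocallyCompactSpace X := ChartedSpace.locallyCompactSpace (EuclideanSpace ℝ (Fin n)) X
  let _ : MetricSpace X := TopologicalSpace.metrizableSpaceMetric X
  obtain ⟨f, hf⟩ := SmoothPartitionOfUnity.exists_isSubordinate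
    𝓘(ℝ, EuclideanSpace ℝ (Fin n)) Y.isClosed (fun φ : A => φ.1.source)
    (fun φ => φ.1.open_source) (by simpa [iUnion_subtype] using hA.cover)
  let ρ : A → X → ℝ := fun i => f i
  let ψ : A → OpenPartialHomeomorph X (LocalModel 𝔽 c m) := fun i => i.1
  have hpiece : ∀ y : Y.carrier, ∃ e : OpenPartialHomeomorph X Y.NormalBundle,
      (y : X) ∈ e.source ∧ e y = Y.zeroVec y y.2 ∧
      ContMDiffOn 𝓘(ℝ, EuclideanSpace ℝ (Fin n)) 𝓘(ℝ, LocalModel 𝔽 c m) ∞ e e.source ∧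
      ContMDiffOn 𝓘(ℝ, LocalModel 𝔽 c m) 𝓘(ℝ, EuclideanSpace ℝ (Fin n)) ∞ e.symm e.target ∧
      (∀ x ∈ e.source, IsRelated ρ ψ x (e x)) ∧
      (∀ᶠ p in 𝓝 ((y : X), (y : X)), ∀ q : Y.NormalBundle, q.base = p.2 →
        IsRelated ρ ψ p.1 q → p.1 ∈ e.source ∧ e p.1 = q) ∧
      ∃ β ∈ A, (y : X) ∈ β.source ∧ ∃ h : IsChartFor (n := n) Y.carrier β,
        ∃ p : Y.NormalBundle,
          (∃ L : LocalModel 𝔽 c m ≃L[ℝ] LocalModel 𝔽 c m, (∀ v, (L v).1 = v.1) ∧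
            HasFDerivAt (normalHomeo β h p ∘ e ∘ β.symm)
              (L : LocalModel 𝔽 c m →L[ℝ] LocalModel 𝔽 c m) (β y)) ∧
          CompatAt (e ≫ₕ normalHomeo β h p) β y := by
    rintro ⟨y, hy⟩
    obtain ⟨β, hβA, hs⟩ := mem_iUnion₂.1 (hA.cover hy)
    have h := hA.isChartFor β hβA
    -- The topological supports through `y` are used rather than the indices with `ρ i y ≠ 0`:
    -- subordination still puts `y` in each of these charts, and no other `ρ i` is nonzero near `y`.
    have hJs : ∀ i ∈ f.fintsupport y, y ∈ (ψ i).source := fun i hi =>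
      hf i ((f.mem_fintsupport_iff y i).1 hi)
    obtain ⟨e, h1, h2, h3, h4, h5, h6, h7, h8⟩ := exists_local_diffeo (J := f.fintsupport y)
      (ρ := ρ) (ψ := ψ) h (Y.zeroVec y hy) (fun i _ => hA.isChartFor _ i.2) hs hJs hy
      (fun i => (f i).contMDiff)
      (by
        obtain ⟨i, hi⟩ := f.exists_pos_of_mem hy
        exact ⟨i, f.finsupport_subset_fintsupport y ((f.mem_finsupport y).2 hi.ne'), hi.ne'⟩)
      (by
        filter_upwards [f.eventually_finsupport_subset y] with x hx i hi
        by_contra hne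
        exact hi (hx ((f.mem_finsupport x).2 hne)))
      (fun i hi => hA.compatAt i.2 hβA (hJs i hi) hs)
      (fun i hi => hA.compatAt hβA i.2 hs (hJs i hi))
    exact ⟨e, h1, h2, h3, h4, h5, h6, β, hβA, hs, h, _, h7, h8⟩
  choose e hes hey hsm hsm' hR hloc hβ using hpiece
  obtain ⟨Θ, hSΘ, hΘy, hΘ⟩ := exists_glued_homeomorph hY continuous_base (R := IsRelated ρ ψ) e
    hes (fun y => by rw [hey]; rfl) hR hloc
  refine ⟨Θ, ?_, ?_, fun y hy => ?_⟩
  · intro x hx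
    obtain ⟨y, hxy, he⟩ := hΘ x hx
    exact (((hsm y).contMDiffAt ((e y).open_source.mem_nhds hxy)).congr_of_eventuallyEq
      he).contMDiffWithinAt
  · intro q hq
    obtain ⟨y, hxy, he⟩ := hΘ _ (Θ.map_target hq)
    have h1 := eventuallyEq_symm_of_eventuallyEq (Θ.map_target hq) hxy he
    have h2 := he.eq_of_nhds
    rw [Θ.right_inv hq] at h1 h2
    exact (((hsm' y).contMDiffAt ((e y).open_target.mem_nhds
      (h2 ▸ (e y).map_source hxy))).congr_of_eventuallyEq h1).contMDiffWithinAt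
  · have he := hΘy ⟨y, hy⟩
    obtain ⟨β, hβA, hs, h, p, ⟨L, hL, hd⟩, hc⟩ := hβ ⟨y, hy⟩
    refine ⟨hSΘ hy, he.eq_of_nhds.trans (hey ⟨y, hy⟩), β, hβA, hs, h, p, ⟨L, hL, ?_⟩, ?_⟩
    · refine hd.congr_of_eventuallyEq ?_
      have hct : Filter.Tendsto β.symm (𝓝 (β y)) (𝓝 y) := by
        have := β.symm.continuousAt (x := β y) (β.map_source hs)
        rwa [ContinuousAt, β.left_inv hs] at this
      filter_upwards [hct.eventually he] with a ha
      simp only [Function.comp_apply, ha]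
    · refine hc.congr_left hs ?_
      filter_upwards [he] with x hx
      simp only [OpenPartialHomeomorph.coe_trans, Function.comp_apply, hx]

end ClosedSubmanifold

end Blowup

end

theorem mainTheorem2 {𝔽 : Type*} [RCLike 𝔽] {c m n : ℕ} {X : Type*} [TopologicalSpace X]
    [T2Space X] [SecondCountableTopology X] [ChartedSpace (EuclideanSpace ℝ (Fin n)) X]
    [IsManifold 𝓘(ℝ, EuclideanSpace ℝ (Fin n)) ∞ X]
    (Y : Blowup.ClosedSubmanifold 𝔽 c m n X) (hY : Y.carrier.Nonempty)
    (A : Set (OpenPartialHomeomorph X (Blowup.LocalModel 𝔽 c m))) (hA : Y.IsAtlas A) :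
    ∃ Ψ : OpenPartialHomeomorph Y.NormalBundle X, Y.IsTubularNbhd Ψ ∧
      ∀ B : Set (OpenPartialHomeomorph X (Blowup.LocalModel 𝔽 c m)),
        Y.IsCutOutAtlas A Ψ B → Y.AtlasEquiv A B := by
  obtain ⟨Θ, hs, hs', hΘ⟩ := Blowup.ClosedSubmanifold.exists_tubular_map hY hA
  have hinv : ∀ y hy, Θ.symm (Y.zeroVec y hy) = y := fun y hy => by
    rw [← (hΘ y hy).2.1, Θ.left_inv (hΘ y hy).1]
  have hzero : ∀ y hy, Y.zeroVec y hy ∈ Θ.target := fun y hy => by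
    rw [← (hΘ y hy).2.1]
    exact Θ.map_source (hΘ y hy).1
  refine ⟨Θ.symm, ⟨hs', hs, hzero, hinv, ?_⟩, fun B hB => ?_⟩
  · intro y hy v
    obtain ⟨-, -, β, -, hyβ, h, p, ⟨L, hL, hd⟩, -⟩ := hΘ y hy
    exact Blowup.ClosedSubmanifold.deriv_vertical_of_hasFDerivAt h p (Ψ := Θ.symm) hs' hy hyβ
      (hzero y hy) (hinv y hy) hL hd v
  · refine hA.atlasEquiv (fun φ hφ => ?_) hB.cover fun φ hφ α hα y hy hyφ hyα => ?_
    · obtain ⟨Φ, hΦ, e⟩ := hB.cutOut φ hφ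
      exact (Blowup.ClosedSubmanifold.isChartFor_trans hA hΦ hs hs' (fun y hy => (hΘ y hy).1)
        fun y hy => (hΘ y hy).2.1).congr_source e
    · obtain ⟨Φ, hΦ, e⟩ := hB.cutOut φ hφ
      obtain ⟨hyΘ, h0, β, hβA, hyβ, h, p, -, hc⟩ := hΘ y hy
      have hyΦ : Y.zeroVec y hy ∈ Φ.source := by
        have h1 : y ∈ (Θ ≫ₕ Φ).source := e.1 ▸ hyφ
        rw [← h0]
        exact h1.2
      -- The linear factor for `Θ` is available only in the chart `β` chosen at `y`; a transition
      -- inside the atlas carries it to `α`, and `φ` agrees with `Θ ≫ₕ Φ` near `y`.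
      refine ((hΦ.compatAt hβA h p hs hy h0 hyΘ hyβ hyΦ hc).trans (hA.compatAt hβA hα hyβ hyα)
        h (hA.isChartFor α hα) hyβ hyα).congr_left hyα ?_
      exact Filter.eventually_of_mem (φ.open_source.mem_nhds hyφ) fun x hx => e.2 hx
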